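/- Notation. For $A,B\subseteq\omega$ write $A\subseteq^* B$ if $A\setminus B$ is finite, and $A=^*B$ if $A\subseteq^*B$ and $B\subseteq^*A$; $\mathcal P(\omega)/\mathrm{fin}$ is the set of $=^*$-classes $[A]$, partially ordered by $[A]\le[B]\iff A\subseteq^*B$. A P-point is a non-principal ultrafilter $\mathcal U$ on $\omega$ such that every $f:\omega\to\omega$ is finite-to-one or constant on some member of $\mathcal U$. For ultrafilters on $\omega$, $\mathcal U\le_{RK}\mathcal V$ means that there is $f:\omega\to\omega$ such that for all $a\subseteq\omega$, $a\in\mathcal U\iff f^{-1}(a)\in\mathcal V$; and $\mathcal U\le_T\mathcal V$ means that there is a map from $\mathcal V$ to $\mathcal U$ sending every cofinal subset of the directed set $\langle\mathcal V,\supseteq\rangle$ to a cofinal subset of $\langle\mathcal U,\supseteq\rangle$. A subset of a poset $\mathbb P$ is centered if any finitely many of its elements have a lower bound in $\mathbb P$; $\mathbb P$ is $\sigma$-centered if it is a union of countably many centered subsets. $\mathrm{MA}(\sigma\text{-centered})$ is the statement: for every non-empty $\sigma$-centered poset $\mathbb P$ and every family of fewer than $2^{\aleph_0}$ dense subsets of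 $\mathbb P$, there is a filter $G\subseteq\mathbb P$ meeting every member of the family. Theorem. Assume $\mathrm{MA}(\sigma\text{-centered})$. Then there are a set $\mathscr X\subseteq\mathcal P(\omega)$ and ultrafilters $\langle\mathcal U_A:A\in\mathscr X\rangle$ on $\omega$ such that: 1. $\mathscr X$ is a set of representatives for $\mathcal P(\omega)/\mathrm{fin}$: distinct $A,B\in\mathscr X$ satisfy $A\ne^*B$, and for every $C\subseteq\omega$ there is $A\in\mathscr X$ with $C=^*A$; 2. for each $A\in\mathscr X$, $\mathcal U_A$ is a P-point; 3. for all $A,B\in\mathscr X$, if $A\subseteq^*B$ then $\mathcal U_A\le_{RK}\mathcal U_B$; 4. for all $A,B\in\mathscr X$, if $B\not\subseteq^*A$ then $\mathcal U_B\not\le_T\mathcal U_A$. Consequently $\mathcal P(\omega)/\mathrm{fin}$ embeds into the P-points under both orders: setting $\mathcal V_{[A]}=\mathcal U_A$ for $A\in\mathscr X$, each $\mathcal V_x$ ($x\in\mathcal P(\omega)/\mathrm{fin}$) is a P-point, and for all $x,y\in\mathcal P(\omega)/\mathrm{fin}$, $x\le y\iff\mathcal V_x\le_{RK}\mathcal V_y\iff\mathcal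 V_x\le_T\mathcal V_y$. -/

import Mathlib

/-! ### The quotient of the power set of the naturals by the ideal of finite sets -/

/-- `A ⊆* B`: the set `A \ B` is finite. -/
def AlmostSubset (A B : Set ℕ) : Prop := (A \ B).Finite

/-- `A =* B`. -/
def AlmostEq (A B : Set ℕ) : Prop := AlmostSubset A B ∧ AlmostSubset B A

theorem AlmostSubset.refl (A : Set ℕ) : AlmostSubset A A := by
  simp [AlmostSubset]

theorem AlmostSubset.trans {A B C : Set ℕ} (h₁ : AlmostSubset A B) (h₂ : AlmostSubset B C) :
    AlmostSubset A C :=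
  (Set.Finite.union h₁ h₂).subset fun x hx => by
    by_cases hB : x ∈ B
    · exact Or.inr ⟨hB, hx.2⟩
    · exact Or.inl ⟨hx.1, hB⟩

/-- Equality modulo a finite set, as an equivalence relation. -/
def almostEqSetoid : Setoid (Set ℕ) where
  r := AlmostEq
  iseqv :=
    { refl := fun A => ⟨AlmostSubset.refl A, AlmostSubset.refl A⟩
      symm := fun h => ⟨h.2, h.1⟩
      trans := fun h₁ h₂ => ⟨h₁.1.trans h₂.1, h₂.2.trans h₁.2⟩ }

/-- The quotient `P(ω)/fin`. -/
def PowModFin : Type := Quotient almostEqSetoid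

/-- The class `[A]` of `A` in `P(ω)/fin`. -/
def PowModFin.mk (A : Set ℕ) : PowModFin := Quotient.mk almostEqSetoid A

/-- The natural partial order: `[A] ≤ [B]` iff `A ⊆* B`. -/
instance : PartialOrder PowModFin where
  le := Quotient.lift₂ AlmostSubset fun _ _ _ _ h₁ h₂ => propext
    ⟨fun h => (h₁.2.trans h).trans h₂.1, fun h => (h₁.1.trans h).trans h₂.2⟩
  le_refl x := Quotient.inductionOn x AlmostSubset.refl
  le_trans x y z := Quotient.inductionOn₃ x y z fun _ _ _ h₁ h₂ => AlmostSubset.trans h₁ h₂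
  le_antisymm x y := Quotient.inductionOn₂ x y fun _ _ h₁ h₂ => Quotient.sound ⟨h₁, h₂⟩

theorem PowModFin.mk_le_mk (A B : Set ℕ) :
    PowModFin.mk A ≤ PowModFin.mk B ↔ AlmostSubset A B := Iff.rfl

/-! ### Martin's axiom for σ-centered posets -/

/-- A subset of a poset is centered if any finitely many of its elements have a lower bound in
the poset. -/
def IsCenteredSubset {P : Type*} [PartialOrder P] (X : Set P) : Prop :=
  ∀ s : Finset P, (s : Set P) ⊆ X → ∃ p : P, ∀ x ∈ s, p ≤ x

/-- A poset is σ-centered if it is the union of countably many centered subsets. -/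
def IsSigmaCentered (P : Type*) [PartialOrder P] : Prop :=
  ∃ Q : ℕ → Set P, (∀ n, IsCenteredSubset (Q n)) ∧ ⋃ n, Q n = Set.univ

/-- Density in the sense of forcing: every element has an element of `D` below it. -/
def IsForcingDense {P : Type*} [PartialOrder P] (D : Set P) : Prop :=
  ∀ p : P, ∃ q ∈ D, q ≤ p

/-- `MA(σ-centered)`: for every (non-empty) σ-centered poset and every family of fewer than
continuum many dense subsets, some filter on the poset meets all of them. -/
def MASigmaCentered : Prop :=
  ∀ (P : Type) [PartialOrder P] [Nonempty P], IsSigmaCentered P →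
    ∀ 𝒟 : Set (Set P), Cardinal.mk 𝒟 < Cardinal.continuum → (∀ D ∈ 𝒟, IsForcingDense D) →
      ∃ G : Order.PFilter P, ∀ D ∈ 𝒟, ((G : Set P) ∩ D).Nonempty

/-! ### P-points and reducibilities -/

/-- A P-point: a non-principal ultrafilter `U` on `ω` such that every `f : ω → ω` is
finite-to-one or constant on some member of `U`. -/
def IsPPoint (U : Ultrafilter ℕ) : Prop :=
  (∀ F : Set ℕ, F.Finite → Fᶜ ∈ U) ∧
    ∀ f : ℕ → ℕ, ∃ A ∈ U, (∀ m, {n | n ∈ A ∧ f n = m}.Finite) ∨ (∃ m, ∀ n ∈ A, f n = m)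

/-- Rudin–Keisler reducibility of filters, `F ≤_RK G`. -/
def RKLE {X Y : Type*} (F : Filter X) (G : Filter Y) : Prop :=
  ∃ f : Y → X, ∀ a : Set X, a ∈ F ↔ f ⁻¹' a ∈ G

/-- Tukey reducibility `D ≤_T E` of directed sets: there is a map `E → D` that sends cofinal
subsets of `E` to cofinal subsets of `D`. -/
def TukeyLE (D E : Type*) [Preorder D] [IsDirectedOrder D] [Preorder E] [IsDirectedOrder E] :
    Prop :=
  ∃ g : E → D, ∀ S : Set E, IsCofinal S → IsCofinal (g '' S)

/-- The members of an ultrafilter on `ω`, ordered by reverse inclusion. -/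
abbrev Ultrafilter.RevIncl (U : Ultrafilter ℕ) : Type := {A : Set ℕ // A ∈ U}ᵒᵈ

instance (U : Ultrafilter ℕ) : IsDirectedOrder U.RevIncl where
  directed a b :=
    ⟨OrderDual.toDual ⟨(OrderDual.ofDual a).1 ∩ (OrderDual.ofDual b).1,
        Filter.inter_mem (OrderDual.ofDual a).2 (OrderDual.ofDual b).2⟩,
      fun _ hx => hx.1, fun _ hx => hx.2⟩

/-! All the P-points are projections of one generic ultrafilter `𝒰` on `Blocks`. A point of block n
assigns values to n labels. Each index x has a set of labels `φ x n` in every block, and `U_x` is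
the image of `𝒰` under forgetting the values at labels outside `φ x n`. If x lies below y, then `φ x
n ⊆ φ y n` for `𝒰`-almost all blocks, so the x-projection factors through the y-projection and `U_x`
is RK-below `U_y`. If y does not lie below x, there are labels in `φ y n` but not in `φ x n`. Values
at such labels are invisible to `U_x`, and this independence defeats every Tukey map.

`𝒰` is generated by a tower of length continuum whose members are made of boxes (products of value
sets) that look generic (`Good`) for any finitely many indices. A product Ramsey theorem
(`exists_product_ramsey`) lets a good box be homogenized for any set, so the tower can decide sets.
MA enters only through pseudo-intersections, which carry the tower through every stage
(`exists_stage`). At each stage the new set also diagonalizes a sequence, which yields the P-point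
property, and avoids one finitary map.

Avoiding finitary maps is enough for Tukey reducibility. A reduction gives a monotone map H with
cofinal range. By diagonalization, membership in H(a) of a point of block n is decided by the part
of a in blocks up to n, so H is governed by a map on finite sets, and there are only continuum many
of those (`IsGeneric.not_exists_monotone`). -/

open Filter Set Cardinal

namespace PPointEmbedding

/-! ### Pseudo-intersections from Martin's axiom -/

/-- Finite approximations to a pseudo-intersection of the family `B`: a finite set together with a
finite list of promises. -/
structure PseudoCond {Q I : Type} (B : I → Set Q) where
  /-- the finite set approximated so far -/
  stem : Finset Q
  /-- the promises -/
  side : Finset I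

instance {Q I : Type} (B : I → Set Q) : PartialOrder (PseudoCond B) where
  le p q := q.stem ⊆ p.stem ∧ q.side ⊆ p.side ∧ ∀ x ∈ p.stem, x ∉ q.stem → ∀ i ∈ q.side, x ∈ B i
  le_refl p := ⟨Finset.Subset.refl _, Finset.Subset.refl _, fun x h h' => absurd h h'⟩
  le_trans p q r h₁ h₂ := by
    refine ⟨h₂.1.trans h₁.1, h₂.2.1.trans h₁.2.1, fun x hx hxr i hi => ?_⟩
    by_cases hq : x ∈ q.stem
    · exact h₂.2.2 x hq hxr i hi
    · exact h₁.2.2 x hx hq i (h₂.2.1 hi)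
  le_antisymm p q h₁ h₂ := by
    cases p; cases q
    congr 1
    · exact Finset.Subset.antisymm h₂.1 h₁.1
    · exact Finset.Subset.antisymm h₂.2.1 h₁.2.1

/-- Conditions with the same stem have a common extension, obtained by pooling their promises; as
`Q` is countable there are only countably many stems. The infinite finite-intersections hypothesis
lets stems grow. -/
theorem exists_pseudoIntersection (hMA : MASigmaCentered) {Q I : Type} [Countable Q]
    (hI : #I < continuum) (B : I → Set Q)
    (hB : ∀ s : Finset I, {x | ∀ i ∈ s, x ∈ B i}.Infinite) :
    ∃ Z : Set Q, Z.Infinite ∧ ∀ i, (Z \ B i).Finite := by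
  classical
  have : Nonempty (PseudoCond B) := ⟨⟨∅, ∅⟩⟩
  have hσ : IsSigmaCentered (PseudoCond B) := by
    obtain ⟨e, he⟩ := exists_surjective_nat (Finset Q)
    refine ⟨fun n => {p | p.stem = e n}, fun n s hs => ?_, ?_⟩
    · refine ⟨⟨e n, s.biUnion PseudoCond.side⟩, fun x hx => ?_⟩
      have hxs : x.stem = e n := hs hx
      refine ⟨hxs.le, Finset.subset_biUnion_of_mem _ hx, fun y hy hy' => absurd ?_ hy'⟩
      rw [hxs]; exact hy
    · ext p
      obtain ⟨n, hn⟩ := he p.stem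
      simp only [mem_iUnion, mem_univ, iff_true]
      exact ⟨n, hn.symm⟩
  have hext : ∀ p : PseudoCond B, ∃ x, x ∉ p.stem ∧ ∀ i ∈ p.side, x ∈ B i := fun p => by
    obtain ⟨x, hx, hx'⟩ := (hB p.side).exists_notMem_finset p.stem
    exact ⟨x, hx', hx⟩
  let D : I ⊕ ℕ → Set (PseudoCond B) :=
    Sum.elim (fun i => {p | i ∈ p.side}) (fun k => {p | k ≤ p.stem.card})
  have hcard : #(range D) < continuum := by
    refine mk_range_le.trans_lt ?_
    rw [mk_sum, lift_id, lift_id, mk_nat]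
    exact add_lt_of_lt aleph0_le_continuum hI aleph0_lt_continuum
  obtain ⟨G, hG⟩ := hMA (PseudoCond B) hσ (range D) hcard (by
    rintro _ ⟨i | k, rfl⟩
    · intro p
      exact ⟨⟨p.stem, insert i p.side⟩, by simp [D], Finset.Subset.refl _,
        Finset.subset_insert _ _, fun x h h' => absurd h h'⟩
    · intro p
      induction k with
      | zero => exact ⟨p, by simp [D], le_refl _⟩
      | succ k ih =>
        obtain ⟨q, hq, hqp⟩ := ih
        obtain ⟨x, hx, hxB⟩ := hext q
        refine ⟨⟨insert x q.stem, q.side⟩, ?_, le_trans ?_ hqp⟩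
        · have hq' : k ≤ q.stem.card := hq
          simp only [D, Sum.elim_inr, mem_ofPred_eq]
          rw [Finset.card_insert_of_notMem hx]; omega
        · refine ⟨Finset.subset_insert _ _, Finset.Subset.refl _, fun y hy hy' i hi => ?_⟩
          rcases Finset.mem_insert.1 hy with rfl | h
          · exact hxB i hi
          · exact absurd h hy')
  refine ⟨{x | ∃ p ∈ G, x ∈ p.stem}, ?_, fun i => ?_⟩
  · intro hfin
    obtain ⟨p, hpG, hp⟩ := hG _ ⟨Sum.inr (hfin.toFinset.card + 1), rfl⟩
    have hp' : hfin.toFinset.card + 1 ≤ p.stem.card := hp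
    have : p.stem ⊆ hfin.toFinset := fun x hx => by
      simpa using ⟨p, hpG, hx⟩
    have := Finset.card_le_card this
    omega
  · obtain ⟨p, hpG, hp⟩ := hG _ ⟨Sum.inl i, rfl⟩
    refine p.stem.finite_toSet.subset ?_
    rintro x ⟨⟨q, hqG, hx⟩, hxB⟩
    obtain ⟨r, hrG, hrp, hrq⟩ := G.directed p hpG q hqG
    by_contra hxp
    exact hxB (hrp.2.2 x (hrq.1 hx) hxp i hp)

/-! ### Transfinite recursion and bookkeeping -/

/-- Since `P α` looks only at values up to α, the value at α can be chosen from the earlier ones;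
later values are irrelevant. -/
theorem exists_forall_of_step {ι D : Type*} [LinearOrder ι] [WellFoundedLT ι] [Nonempty D]
    (P : ι → (ι → D) → Prop)
    (hcongr : ∀ α H H', (∀ β ≤ α, H β = H' β) → P α H → P α H')
    (step : ∀ α H, (∀ β < α, P β H) → ∃ d, P α (Function.update H α d)) :
    ∃ H, ∀ α, P α H := by
  classical
  let ext : ∀ α : ι, (∀ β, β < α → D) → D → ι → D := fun α R d β =>
    if h : β < α then R β h else d
  let F : ∀ α : ι, (∀ β, β < α → D) → D := fun α R => Classical.epsilon fun d => P α (ext α R d)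
  let H : ι → D := (wellFounded_lt (α := ι)).fix F
  have hH : ∀ α, H α = F α fun β _ => H β := fun α => WellFounded.fix_eq _ _ _
  refine ⟨H, fun α => ?_⟩
  induction α using (wellFounded_lt (α := ι)).induction with
  | _ α ih =>
    obtain ⟨d, hd⟩ := step α H ih
    have hagree : ∀ d', ∀ β ≤ α,
        Function.update H α d' β = ext α (fun β _ => H β) d' β := by
      intro d' β hβ
      rcases hβ.lt_or_eq with h | rfl
      · simp [ext, h, h.ne]
      · simp [ext]
    have h1 : P α (ext α (fun β _ => H β) (H α)) := by
      rw [hH α]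
      exact Classical.epsilon_spec (p := fun d => P α (ext α (fun β _ => H β) d))
        ⟨d, hcongr _ _ _ (hagree d) hd⟩
    refine hcongr _ _ _ (fun β hβ => ?_) h1
    rw [← hagree _ β hβ]
    simp

/-- Tasks must recur cofinally because one that names two indices can be treated only at a stage
above both. With a surjection onto `T × ι`, each t has continuum many preimages, too many for an
initial segment. -/
theorem exists_bookkeeping {ι T : Type} [LinearOrder ι] [Nonempty T]
    (hι : #ι = continuum) (hlt : ∀ α : ι, #(Iio α) < continuum) (hT : #T ≤ continuum) :
    ∃ e : ι → T, ∀ t γ, ∃ α ≥ γ, e α = t := by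
  have h : #(T × ι) ≤ #ι := by
    rw [mk_prod, lift_id, lift_id, hι]
    exact (mul_le_mul_left hT _).trans continuum_mul_self.le
  have : Nonempty ι := by
    rw [← mk_ne_zero_iff, hι]; exact continuum_ne_zero
  obtain ⟨s, hs⟩ : ∃ s : ι → T × ι, Function.Surjective s := by
    obtain ⟨f⟩ := (le_def _ _).1 h
    exact ⟨Function.invFun f, Function.invFun_surjective f.injective⟩
  refine ⟨fun α => (s α).1, fun t γ => ?_⟩
  by_contra! hcon
  refine (hlt γ).not_ge ?_
  rw [← hι]
  choose g hg using hs
  refine mk_le_of_injective (f := fun i : ι => (⟨g (t, i), ?_⟩ : Iio γ)) fun i j hij => ?_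
  · by_contra hge
    exact hcon _ (not_lt.1 hge) (by rw [hg])
  · have := congrArg s (Subtype.ext_iff.1 hij)
    rw [hg, hg] at this
    exact (Prod.ext_iff.1 this).2

/-! ### Product Ramsey theorem -/

/-- Induction on the number of free coordinates: fix `r * m` values at one of them, colour the rest
by the induced function from these values to colours, and apply the pigeonhole principle to the
resulting constant function. The bound does not depend on the size of `K`, so it is uniform over all
blocks. -/
theorem exists_product_ramsey (l : ℕ) : ∀ r m : ℕ, ∃ R : ℕ, ∀ {K V : Type} [DecidableEq K]
    (A : Finset K), A.card ≤ l → ∀ E : K → Finset V, (∀ k ∈ A, R ≤ (E k).card) →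
    ∀ (g : K → V) {C : Type} [Fintype C], Fintype.card C ≤ r → ∀ c : (K → V) → C,
    ∃ E' : K → Finset V, (∀ k ∈ A, E' k ⊆ E k ∧ m ≤ (E' k).card) ∧
      ∃ χ, ∀ f, (∀ k ∈ A, f k ∈ E' k) → (∀ k ∉ A, f k = g k) → c f = χ := by
  classical
  induction l with
  | zero =>
    refine fun r m => ⟨0, fun A hA E _ g C _ _ c => ⟨E, ?_, c g, fun f _ hf => ?_⟩⟩
    · simp [Finset.card_eq_zero.1 (Nat.le_zero.1 hA)]
    · congr 1
      funext k
      exact hf k (by simp [Finset.card_eq_zero.1 (Nat.le_zero.1 hA)])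
  | succ l ih =>
    intro r m
    obtain ⟨R, hR⟩ := ih (r ^ (r * m)) m
    refine ⟨max R (r * m), fun {K V} _ A hA E hE g C _ hC c => ?_⟩
    rcases A.eq_empty_or_nonempty with rfl | ⟨k, hk⟩
    · refine ⟨E, by simp, c g, fun f _ hf => ?_⟩
      congr 1
      funext k
      exact hf k (by simp)
    obtain ⟨X, hXE, hX⟩ := Finset.exists_subset_card_eq ((le_max_right _ _).trans (hE k hk))
    obtain ⟨E'', hE'', χ, hχ⟩ := hR (A.erase k)
      (by rw [Finset.card_erase_of_mem hk]; omega) E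
      (fun j hj => (le_max_left _ _).trans (hE j (Finset.mem_of_mem_erase hj))) g
      (C := X → C) (by
        rw [Fintype.card_fun, Fintype.card_coe, hX]
        exact Nat.pow_le_pow_left hC _) (fun f x => c (Function.update f k x))
    have : Nonempty C := ⟨c g⟩
    obtain ⟨χ₀, -, hχ₀⟩ := Finset.exists_le_card_fiber_of_mul_le_card_of_maps_to
      (s := (Finset.univ : Finset X)) (t := (Finset.univ : Finset C)) (f := χ) (n := m)
      (fun _ _ => Finset.mem_univ _) Finset.univ_nonempty (by
        rw [Finset.card_univ, Finset.card_univ, Fintype.card_coe, hX]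
        exact Nat.mul_le_mul_right _ hC)
    refine ⟨Function.update E'' k
      ((Finset.univ.filter fun x : X => χ x = χ₀).map (Function.Embedding.subtype _)), ?_, χ₀, ?_⟩
    · intro j hj
      by_cases hjk : j = k
      · subst hjk
        simp only [Function.update_self, Finset.card_map]
        refine ⟨fun x hx => ?_, hχ₀⟩
        obtain ⟨y, -, rfl⟩ := Finset.mem_map.1 hx
        exact hXE y.2
      · rw [Function.update_of_ne hjk]
        exact hE'' j (Finset.mem_erase.2 ⟨hjk, hj⟩)
    · intro f hf hfg
      have hfk := hf k hk
      rw [Function.update_self] at hfk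
      obtain ⟨y, hy, hyf⟩ := Finset.mem_map.1 hfk
      have h := hχ (Function.update f k (g k)) (fun j hj => ?_) (fun j hj => ?_)
      · have h' := congrFun h y
        rw [(Finset.mem_filter.1 hy).2] at h'
        rw [← h']
        have hyf' : (y : V) = f k := hyf
        simp [hyf']
      · have hjk := (Finset.mem_erase.1 hj).1
        have := hf j (Finset.mem_of_mem_erase hj)
        rwa [Function.update_of_ne hjk] at this ⊢
      · by_cases hjk : j = k
        · subst hjk; simp
        · rw [Function.update_of_ne hjk]
          exact hfg j fun hjA => hj (Finset.mem_erase.2 ⟨hjk, hjA⟩)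

/-! ### Blocks and boxes -/

/-- The countable set carrying the ultrafilters; its `n`-th block consists of the self-maps of
`Fin n`, thought of as assigning values to labels. -/
abbrev Blocks : Type := Σ n : ℕ, Fin n → Fin n

/-- Keep the values at the labels in `a` only. -/
def proj {n : ℕ} (a : Finset (Fin n)) (g : Fin n → Fin n) : Fin n → Fin n :=
  fun k => if k ∈ a then g k else ⟨0, k.pos⟩

theorem proj_proj {n : ℕ} {a b : Finset (Fin n)} (h : a ⊆ b) (g : Fin n → Fin n) :
    proj a (proj b g) = proj a g := by
  funext k
  by_cases hk : k ∈ a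
  · simp [proj, hk, h hk]
  · simp [proj, hk]

/-- The points in the blocks up to `i`. -/
def initialBlocks (i : ℕ) : Finset Blocks := (Finset.range (i + 1)).sigma fun _ => Finset.univ

theorem mem_initialBlocks {i : ℕ} {p : Blocks} : p ∈ initialBlocks i ↔ p.1 ≤ i := by
  simp [initialBlocks]

/-- With values of labels ranging over `E`, the box `E` looks generic for the elements of `F`: the
label sets `φ β n`, `β ∈ F`, increase with `β`, and every type over `F` compatible with this is
realized by at least `m` labels at which `E` is large. -/
structure Good {ι : Type*} (r : ι → ι → Prop) (φ : ι → ∀ n, Finset (Fin n)) (F : Finset ι) (m : ℕ)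
    {n : ℕ} (E : Fin n → Finset (Fin n)) : Prop where
  nonempty : ∀ k, (E k).Nonempty
  mono : ∀ β ∈ F, ∀ γ ∈ F, r β γ → φ β n ⊆ φ γ n
  types : ∀ T ⊆ F, (∀ β ∈ T, ∀ γ ∈ F, r β γ → γ ∈ T) →
    ∃ A : Finset (Fin n), m ≤ A.card ∧ ∀ k ∈ A, m ≤ (E k).card ∧ ∀ β ∈ F, k ∈ φ β n ↔ β ∈ T

section Good

variable {ι : Type*} {r : ι → ι → Prop} {φ : ι → ∀ n, Finset (Fin n)} {F : Finset ι} {m n : ℕ}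
  {E : Fin n → Finset (Fin n)}

theorem Good.congr {φ' : ι → ∀ n, Finset (Fin n)} (h : Good r φ F m E)
    (hφ : ∀ β ∈ F, φ β = φ' β) : Good r φ' F m E where
  nonempty := h.nonempty
  mono β hβ γ hγ := by rw [← hφ β hβ, ← hφ γ hγ]; exact h.mono β hβ γ hγ
  types T hT hup := by
    obtain ⟨A, hA, hA'⟩ := h.types T hT hup
    exact ⟨A, hA, fun k hk => ⟨(hA' k hk).1, fun β hβ => by rw [← hφ β hβ]; exact (hA' k hk).2 β hβ⟩⟩

/-- A compatible type over the smaller set is the trace of its upward closure in the larger one. -/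
theorem Good.anti (htrans : ∀ a b c, r a b → r b c → r a c) (hrefl : ∀ a, r a a)
    (h : Good r φ F m E) {F' : Finset ι} {m' : ℕ} (hF : F' ⊆ F) (hm : m' ≤ m) :
    Good r φ F' m' E where
  nonempty := h.nonempty
  mono β hβ γ hγ := h.mono β (hF hβ) γ (hF hγ)
  types T hT hup := by
    classical
    obtain ⟨A, hA, hA'⟩ := h.types (F.filter fun β => ∃ τ ∈ T, r τ β) (Finset.filter_subset _ _) (by
      intro β hβ γ hγ hr
      obtain ⟨-, τ, hτ, hτβ⟩ := Finset.mem_filter.1 hβ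
      exact Finset.mem_filter.2 ⟨hγ, τ, hτ, htrans _ _ _ hτβ hr⟩)
    refine ⟨A, hm.trans hA, fun k hk => ⟨hm.trans (hA' k hk).1, fun β hβ => ?_⟩⟩
    rw [(hA' k hk).2 β (hF hβ), Finset.mem_filter]
    exact ⟨fun ⟨_, τ, hτ, hτβ⟩ => hup τ hτ β hβ hτβ, fun hβT => ⟨hF hβ, β, hβT, hrefl β⟩⟩

theorem Good.shrink (h : Good r φ F m E) {E' : Fin n → Finset (Fin n)} {m' : ℕ} (hm' : m' ≤ m)
    (hne : ∀ k, (E' k).Nonempty) (hE : ∀ k, m ≤ (E k).card → m' ≤ (E' k).card) :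
    Good r φ F m' E' where
  nonempty := hne
  mono := h.mono
  types T hT hup := by
    obtain ⟨A, hA, hA'⟩ := h.types T hT hup
    exact ⟨A, hm'.trans hA, fun k hk => ⟨hE k (hA' k hk).1, (hA' k hk).2⟩⟩

/-- Few labels suffice. -/
theorem Good.exists_tame (h : Good r φ F m E) {m' : ℕ} (hm : m' ≤ m) :
    ∃ (A : Finset (Fin n)) (E' : Fin n → Finset (Fin n)), A.card ≤ 2 ^ F.card * m' ∧
      (∀ k, E' k ⊆ E k) ∧ (∀ k ∉ A, (E' k).card = 1) ∧ (∀ k ∈ A, m ≤ (E' k).card) ∧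
      ∀ E'' : Fin n → Finset (Fin n), (∀ k, (E'' k).Nonempty) → (∀ k ∈ A, m' ≤ (E'' k).card) →
        Good r φ F m' E'' := by
  classical
  have hex : ∀ T : Finset ι, ∃ A : Finset (Fin n), A.card ≤ m' ∧ (∀ k ∈ A, m ≤ (E k).card) ∧
      (T ⊆ F → (∀ β ∈ T, ∀ γ ∈ F, r β γ → γ ∈ T) →
        A.card = m' ∧ ∀ k ∈ A, ∀ β ∈ F, k ∈ φ β n ↔ β ∈ T) := by
    intro T
    by_cases hT : T ⊆ F ∧ ∀ β ∈ T, ∀ γ ∈ F, r β γ → γ ∈ T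
    · obtain ⟨A, hA, hA'⟩ := h.types T hT.1 hT.2
      obtain ⟨A', hsub, hcard⟩ := Finset.exists_subset_card_eq (hm.trans hA)
      exact ⟨A', hcard.le, fun k hk => (hA' k (hsub hk)).1,
        fun _ _ => ⟨hcard, fun k hk => (hA' k (hsub hk)).2⟩⟩
    · exact ⟨∅, by simp, by simp, fun h₁ h₂ => absurd ⟨h₁, h₂⟩ hT⟩
  -- The box keeps its values at `m'` labels for each compatible type and is frozen to a single
  -- value elsewhere.
  choose A hAcard hAE hA using hex
  choose e he using h.nonempty
  refine ⟨F.powerset.biUnion A, fun k => if k ∈ F.powerset.biUnion A then E k else {e k},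
    ?_, ?_, ?_, ?_, ?_⟩
  · rw [← Finset.card_powerset]
    exact Finset.card_biUnion_le_card_mul _ _ _ fun T _ => hAcard T
  · intro k
    dsimp only
    split_ifs
    · exact Finset.Subset.refl _
    · simpa using he k
  · intro k hk
    simp only [if_neg hk, Finset.card_singleton]
  · intro k hk
    simp only [if_pos hk]
    obtain ⟨T, -, hT⟩ := Finset.mem_biUnion.1 hk
    exact hAE T k hT
  · intro E'' hne hE''
    refine ⟨hne, h.mono, fun T hT hup => ⟨A T, (hA T hT hup).1.ge, fun k hk => ⟨?_, ?_⟩⟩⟩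
    · exact hE'' k (Finset.mem_biUnion.2 ⟨T, Finset.mem_powerset.2 hT, hk⟩)
    · exact (hA T hT hup).2 k hk

/-- Once all but `2 ^ F.card * m` labels are frozen, the Ramsey bound no longer depends on the
block. -/
theorem exists_good_partition (r : ι → ι → Prop) (φ : ι → ∀ n, Finset (Fin n)) (F : Finset ι)
    (m : ℕ) : ∃ M, ∀ {n : ℕ} (E : Fin n → Finset (Fin n)), Good r φ F M E →
      ∀ a : Set (Fin n → Fin n), ∃ E' : Fin n → Finset (Fin n), (∀ k, E' k ⊆ E k) ∧
        Good r φ F m E' ∧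
        ((∀ g, (∀ k, g k ∈ E' k) → g ∈ a) ∨ ∀ g, (∀ k, g k ∈ E' k) → g ∉ a) := by
  classical
  -- Asking for `m + 1` keeps the boxes nonempty when `m = 0`.
  obtain ⟨R, hR⟩ := exists_product_ramsey (2 ^ F.card * m) 2 (m + 1)
  refine ⟨max R m, fun {n} E hE a => ?_⟩
  obtain ⟨A, E₁, hA, hE₁, hE₁one, hE₁A, hgood⟩ := hE.exists_tame (le_max_right R m)
  obtain ⟨g₀, hg₀⟩ : ∃ g₀ : Fin n → Fin n, ∀ k ∉ A, E₁ k = {g₀ k} := by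
    have : ∀ k, ∃ x, k ∉ A → E₁ k = {x} := fun k => by
      by_cases hk : k ∈ A
      · exact ⟨k, fun h => absurd hk h⟩
      · obtain ⟨x, hx⟩ := Finset.card_eq_one.1 (hE₁one k hk)
        exact ⟨x, fun _ => hx⟩
    choose g hg using this
    exact ⟨g, hg⟩
  obtain ⟨E₂, hE₂, χ, hχ⟩ := hR A hA E₁ (fun k hk => (le_max_left _ _).trans (hE₁A k hk)) g₀
    (C := Bool) (by simp) (fun g => decide (g ∈ a))
  have hin : ∀ g, (∀ k, g k ∈ if k ∈ A then E₂ k else E₁ k) → decide (g ∈ a) = χ := by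
    refine fun g hg => hχ g (fun k hk => ?_) (fun k hk => ?_)
    · simpa [hk] using hg k
    · simpa [hk, hg₀ k hk] using hg k
  refine ⟨fun k => if k ∈ A then E₂ k else E₁ k, fun k => ?_, hgood _ (fun k => ?_) fun k hk => ?_, ?_⟩
  · dsimp only
    split_ifs with hk
    · exact (hE₂ k hk).1.trans (hE₁ k)
    · exact hE₁ k
  · split_ifs with hk
    · exact Finset.card_pos.1 (by have := (hE₂ k hk).2; omega)
    · exact Finset.card_pos.1 (by rw [hE₁one k hk]; exact one_pos)
  · simp only [if_pos hk]
    exact (Nat.le_succ m).trans (hE₂ k hk).2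
  · cases χ with
    | true => exact Or.inl fun g hg => by simpa using hin g hg
    | false => exact Or.inr fun g hg => by simpa using hin g hg

/-- One more element can be accommodated at the cost of halving the norm. -/
theorem Good.exists_insert [DecidableEq ι] (htrans : ∀ a b c, r a b → r b c → r a c)
    (h : Good r φ F (2 * m) E) {α : ι} (hα : α ∉ F) :
    ∃ σ : Finset (Fin n), ∀ φ' : ι → ∀ n, Finset (Fin n), (∀ β ∈ F, φ' β = φ β) → φ' α n = σ →
      Good r φ' (insert α F) m E := by
  classical
  let tp : Fin n → Finset ι := fun k => F.filter fun β => k ∈ φ β n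
  have htp : ∀ k β, β ∈ tp k ↔ β ∈ F ∧ k ∈ φ β n := fun k β => Finset.mem_filter
  have hex : ∀ T : Finset ι, ∃ A B : Finset (Fin n), Disjoint A B ∧
      (T ⊆ F → (∀ β ∈ T, ∀ γ ∈ F, r β γ → γ ∈ T) → m ≤ A.card ∧ m ≤ B.card ∧
        ∀ k ∈ A ∪ B, 2 * m ≤ (E k).card ∧ tp k = T) := by
    intro T
    by_cases hT : T ⊆ F ∧ ∀ β ∈ T, ∀ γ ∈ F, r β γ → γ ∈ T
    · obtain ⟨A, hA, hA'⟩ := h.types T hT.1 hT.2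
      obtain ⟨A', hsub, hcard⟩ := Finset.exists_subset_card_eq (show m ≤ A.card by omega)
      refine ⟨A', A \ A', Finset.disjoint_sdiff, fun _ _ => ⟨hcard.ge, ?_, fun k hk => ?_⟩⟩
      · rw [Finset.card_sdiff_of_subset hsub]; omega
      · rw [Finset.union_sdiff_of_subset hsub] at hk
        refine ⟨(hA' k hk).1, Finset.ext fun β => ?_⟩
        rw [htp]
        exact ⟨fun hβ => ((hA' k hk).2 β hβ.1).1 hβ.2,
          fun hβ => ⟨hT.1 hβ, ((hA' k hk).2 β (hT.1 hβ)).2 hβ⟩⟩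
    · exact ⟨∅, ∅, by simp, fun h₁ h₂ => absurd ⟨h₁, h₂⟩ hT⟩
  choose A B hdisj hAB using hex
  -- The witnesses of each type are split into halves `A` and `B`. A label enters the new set if its
  -- type forces it, or if its type permits it and it lies in the half `A`; permitted but unforced
  -- types are thus realized both inside and outside.
  refine ⟨Finset.univ.filter fun k => (∃ β ∈ tp k, r β α) ∨
    ((∀ γ ∈ F, r α γ → γ ∈ tp k) ∧ k ∈ A (tp k)), fun φ' hφ hσ => ?_⟩
  have hmem : ∀ k, k ∈ φ' α n ↔ (∃ β ∈ tp k, r β α) ∨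
      ((∀ γ ∈ F, r α γ → γ ∈ tp k) ∧ k ∈ A (tp k)) := fun k => by simp [hσ]
  refine ⟨h.nonempty, ?_, ?_⟩
  · intro β hβ γ hγ hr
    rcases Finset.mem_insert.1 hβ with rfl | hβF <;> rcases Finset.mem_insert.1 hγ with rfl | hγF
    · exact Finset.Subset.refl _
    · intro k hk
      rw [hφ γ hγF]
      rcases (hmem k).1 hk with ⟨δ, hδ, hδβ⟩ | ⟨hup, -⟩
      · obtain ⟨hδF, hkδ⟩ := (htp k δ).1 hδ
        exact h.mono δ hδF γ hγF (htrans _ _ _ hδβ hr) hkδ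
      · exact ((htp k γ).1 (hup γ hγF hr)).2
    · intro k hk
      rw [hφ β hβF] at hk
      exact (hmem k).2 (Or.inl ⟨β, (htp k β).2 ⟨hβF, hk⟩, hr⟩)
    · rw [hφ β hβF, hφ γ hγF]
      exact h.mono β hβF γ hγF hr
  · intro T hT hup
    have hTF : T.erase α ⊆ F := fun β hβ =>
      (Finset.mem_insert.1 (hT (Finset.mem_of_mem_erase hβ))).resolve_left (Finset.ne_of_mem_erase hβ)
    obtain ⟨hA, hB, hk⟩ := hAB (T.erase α) hTF (fun β hβ γ hγ hr =>
      Finset.mem_erase.2 ⟨fun hγα => hα (hγα ▸ hγ), hup β (Finset.mem_of_mem_erase hβ) γ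
        (Finset.mem_insert_of_mem hγ) hr⟩)
    have hF : ∀ k, tp k = T.erase α → ∀ β ∈ F, k ∈ φ' β n ↔ β ∈ T := fun k hkT β hβ => by
      rw [hφ β hβ]
      have h1 := htp k β
      rw [hkT, Finset.mem_erase] at h1
      have hne : β ≠ α := fun h => hα (h ▸ hβ)
      tauto
    by_cases hαT : α ∈ T
    · refine ⟨A (T.erase α), hA, fun k hkA => ?_⟩
      obtain ⟨hE, hkT⟩ := hk k (Finset.mem_union_left _ hkA)
      refine ⟨by omega, fun β hβ => ?_⟩
      rcases Finset.mem_insert.1 hβ with rfl | hβF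
      · refine iff_of_true ((hmem k).2 (Or.inr ⟨fun γ hγ hr => ?_, by rwa [hkT]⟩)) hαT
        rw [hkT]
        exact Finset.mem_erase.2 ⟨fun h => hα (h ▸ hγ), hup _ hαT γ (Finset.mem_insert_of_mem hγ) hr⟩
      · exact hF k hkT β hβF
    · refine ⟨B (T.erase α), hB, fun k hkB => ?_⟩
      obtain ⟨hE, hkT⟩ := hk k (Finset.mem_union_right _ hkB)
      refine ⟨by omega, fun β hβ => ?_⟩
      rcases Finset.mem_insert.1 hβ with rfl | hβF
      · refine iff_of_false (fun hmk => ?_) hαT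
        rcases (hmem k).1 hmk with ⟨δ, hδ, hδβ⟩ | ⟨-, hkA⟩
        · rw [hkT] at hδ
          exact hαT (hup δ (Finset.mem_of_mem_erase hδ) _ (Finset.mem_insert_self _ _) hδβ)
        · rw [hkT] at hkA
          exact Finset.disjoint_left.1 (hdisj _) hkA hkB
      · exact hF k hkT β hβF

end Good

/-- Size of a box with `l` active labels that allows to avoid a finitary map, see
`exists_avoiding_box`. -/
def boxSize (l i : ℕ) : ℕ := (i + 1) + 2 ^ ((initialBlocks i).card + (i + 1) ^ l)

theorem boxSize_mono {l l' i i' : ℕ} (hl : l ≤ l') (hi : i ≤ i') : boxSize l i ≤ boxSize l' i' := by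
  have h1 : (initialBlocks i).card ≤ (initialBlocks i').card :=
    Finset.card_le_card fun p hp => mem_initialBlocks.2 ((mem_initialBlocks.1 hp).trans hi)
  have h2 : (i + 1) ^ l ≤ (i' + 1) ^ l' :=
    (Nat.pow_le_pow_left (by omega) l).trans (Nat.pow_le_pow_right (by omega) hl)
  have h3 := Nat.pow_le_pow_right (n := 2) (by omega) (Nat.add_le_add h1 h2)
  unfold boxSize
  omega

/-- A box is `i`-tame if it is large at its active labels, compared to `i` and to their number. -/
def Tame (i : ℕ) {n : ℕ} (E : Fin n → Finset (Fin n)) : Prop :=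
  ∃ A : Finset (Fin n), (∀ k ∉ A, (E k).card = 1) ∧ ∀ k ∈ A, boxSize A.card i ≤ (E k).card

theorem Tame.anti {i i' n : ℕ} {E : Fin n → Finset (Fin n)} (h : Tame i' E) (hi : i ≤ i') :
    Tame i E := by
  obtain ⟨A, h1, h2⟩ := h
  exact ⟨A, h1, fun k hk => (boxSize_mono le_rfl hi).trans (h2 k hk)⟩

/-- Shrinking a tame box to one whose `b`-projection avoids all the values that a map takes on
finite subsets of its `a`-projection, where `b` is not contained in `a`. -/
theorem exists_avoiding_box {i n : ℕ} {E : Fin n → Finset (Fin n)} (hE : Tame i E)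
    {a b : Finset (Fin n)} {k₀ : Fin n} (hk₀ : 2 ≤ (E k₀).card) (hb : k₀ ∈ b) (ha : k₀ ∉ a)
    (f : Finset Blocks → Fin n → Fin n) :
    ∃ E' : Fin n → Finset (Fin n), (∀ k, E' k ⊆ E k) ∧ (∀ k, (E' k).Nonempty) ∧
      (∀ k, 2 ≤ (E k).card → i ≤ (E' k).card) ∧
      ∀ s : Finset Blocks, (∀ p ∈ s, p.1 ≤ i ∨ ∃ g, (∀ k, g k ∈ E' k) ∧ p = ⟨n, proj a g⟩) →
        ∀ g, (∀ k, g k ∈ E' k) → f s ≠ proj b g := by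
  classical
  obtain ⟨A, hA1, hA⟩ := hE
  have hk₀A : k₀ ∈ A := by
    by_contra h
    rw [hA1 k₀ h] at hk₀
    omega
  have hsub : ∀ k, ∃ X ⊆ E k, X.card = if k ∈ A then i + 1 else 1 := fun k => by
    refine Finset.exists_subset_card_eq ?_
    split_ifs with hk
    · exact (Nat.le_add_right _ _).trans (hA k hk)
    · exact (hA1 k hk).ge
  choose X hXE hX using hsub
  -- Every point that can occur in s lies in `W`. As `k₀ ∉ a`, the value at `k₀` does not affect the
  -- a-projection, so a dummy value is put there and `W` is bounded independently of `E k₀`.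
  let W : Finset Blocks := initialBlocks i ∪
    (Fintype.piFinset (Function.update X k₀ {k₀})).image fun g => ⟨n, proj a g⟩
  have hW : W.card ≤ (initialBlocks i).card + (i + 1) ^ A.card := by
    refine (Finset.card_union_le _ _).trans (Nat.add_le_add_left (Finset.card_image_le.trans ?_) _)
    rw [Fintype.card_piFinset]
    calc ∏ k, (Function.update X k₀ {k₀} k).card ≤ ∏ k, (if k ∈ A then i + 1 else 1) := by
          refine Finset.prod_le_prod' fun k _ => ?_
          by_cases hk : k = k₀
          · subst hk; simp [hk₀A]
          · rw [Function.update_of_ne hk, hX]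
      _ = (i + 1) ^ A.card := by simp
  -- Since `k₀ ∈ b`, it suffices to differ from `f s` at `k₀`; the exponential term in `boxSize`
  -- pays for deleting one value per subset of `W`.
  let bad : Finset (Fin n) := W.powerset.image fun s => f s k₀
  have hbad : bad.card ≤ 2 ^ ((initialBlocks i).card + (i + 1) ^ A.card) := by
    refine Finset.card_image_le.trans ?_
    rw [Finset.card_powerset]
    exact Nat.pow_le_pow_right (by omega) hW
  have hbig : i + 1 ≤ (E k₀ \ bad).card := by
    have h1 := hA k₀ hk₀A
    have h2 := Finset.le_card_sdiff bad (E k₀)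
    unfold boxSize at h1
    omega
  refine ⟨Function.update X k₀ (E k₀ \ bad), fun k => ?_, fun k => ?_, fun k hk => ?_, ?_⟩
  · by_cases hk : k = k₀
    · subst hk; simp
    · rw [Function.update_of_ne hk]; exact hXE k
  · by_cases hk : k = k₀
    · subst hk; rw [Function.update_self]; exact Finset.card_pos.1 (by omega)
    · rw [Function.update_of_ne hk]
      refine Finset.card_pos.1 ?_
      rw [hX]; split_ifs <;> omega
  · by_cases hkk : k = k₀
    · subst hkk; rw [Function.update_self]; omega
    · rw [Function.update_of_ne hkk, hX]
      have : k ∈ A := by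
        by_contra h
        rw [hA1 k h] at hk
        omega
      simp [this]
  · intro s hs g hg heq
    have hgk := hg k₀
    rw [Function.update_self, Finset.mem_sdiff] at hgk
    refine hgk.2 (Finset.mem_image.2 ⟨s, Finset.mem_powerset.2 fun p hp => ?_, ?_⟩)
    · rcases hs p hp with h | ⟨g', hg', rfl⟩
      · exact Finset.mem_union_left _ (mem_initialBlocks.2 h)
      · refine Finset.mem_union_right _ (Finset.mem_image.2 ⟨Function.update g' k₀ k₀, ?_, ?_⟩)
        · refine Fintype.mem_piFinset.2 fun k => ?_
          by_cases hk : k = k₀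
          · subst hk; simp
          · have := hg' k
            rw [Function.update_of_ne hk] at this ⊢
            rwa [Function.update_of_ne hk]
        · congr 1
          funext k
          by_cases hk : k = k₀
          · subst hk; simp [proj, ha]
          · simp [proj, Function.update_of_ne hk]
    · rw [heq]; simp [proj, hb]

/-! ### The recursive construction -/

/-- Apply `proj` in every block. -/
def projBlocks (a : ∀ n, Finset (Fin n)) (p : Blocks) : Blocks := ⟨p.1, proj (a p.1) p.2⟩

/-- What is to be taken care of at one stage of the construction: a sequence of sets to be
diagonalized, and a finitary map whose values on projections along `lo` are to be avoided by
projections along `hi`. -/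
structure Task (ι : Type*) where
  /-- the sequence of sets -/
  seq : ℕ → Set Blocks
  /-- the finitary map -/
  code : Finset Blocks → ∀ n, Fin n → Fin n
  /-- the index of the domain -/
  lo : ι
  /-- the index of the range -/
  hi : ι

/-- The inductive hypothesis at stage `α` of the construction of a tower `v` of subsets of `Blocks`
and a family `φ` of sets of labels. -/
structure StageOK {ι : Type*} [LinearOrder ι] (r : ι → ι → Prop) (t : Task ι) (α : ι)
    (v : ι → Set Blocks) (φ : ι → ∀ n, Finset (Fin n)) : Prop where
  frequently : ∃ᶠ n in atTop, ∃ g, ⟨n, g⟩ ∈ v α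
  tower : ∀ β < α, ∀ᶠ n in atTop, ∀ g, ⟨n, g⟩ ∈ v α → ⟨n, g⟩ ∈ v β
  good : ∀ F : Finset ι, (∀ β ∈ F, β ≤ α) → ∀ m, ∀ᶠ n in atTop, ∀ g, ⟨n, g⟩ ∈ v α →
    ∃ E : Fin n → Finset (Fin n), Good r φ F m E ∧ ∀ g', (∀ k, g' k ∈ E k) → ⟨n, g'⟩ ∈ v α
  seq : (∃ i, ∀ p ∈ v α, p ∉ t.seq i) ∨
    ∀ p ∈ v α, ∀ q ∈ v α, p.1 < q.1 → ∀ i ≤ p.1, q ∈ t.seq i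
  code : t.lo ≤ α → t.hi ≤ α → ¬ r t.hi t.lo → ∀ (s : Finset Blocks) (n : ℕ),
    (∀ p ∈ s, p.1 ≤ n ∧ p ∈ projBlocks (φ t.lo) '' v α) →
      ∀ g, ⟨n, g⟩ ∈ v α → t.code s n ≠ proj (φ t.hi n) g

/-! ### Positive sets and a single stage of the recursion -/

section Stage

variable {ι : Type} [LinearOrder ι] {r : ι → ι → Prop} {α : ι}
  {v : ι → Set Blocks} {φ : ι → ∀ n, Finset (Fin n)}

theorem StageOK.congr {t : Task ι} {v' : ι → Set Blocks} {φ' : ι → ∀ n, Finset (Fin n)}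
    (h : StageOK r t α v φ) (hv : ∀ β ≤ α, v β = v' β) (hφ : ∀ β ≤ α, φ β = φ' β) :
    StageOK r t α v' φ' where
  frequently := by rw [← hv α le_rfl]; exact h.frequently
  tower β hβ := by rw [← hv α le_rfl, ← hv β hβ.le]; exact h.tower β hβ
  good F hF m := by
    rw [← hv α le_rfl]
    filter_upwards [h.good F hF m] with n hn g hg
    obtain ⟨E, hE, hE'⟩ := hn g hg
    exact ⟨E, hE.congr fun β hβ => hφ β (hF β hβ), hE'⟩
  seq := by rw [← hv α le_rfl]; exact h.seq
  code h1 h2 := by rw [← hv α le_rfl, ← hφ _ h1, ← hφ _ h2]; exact h.code h1 h2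

/-- `S` is positive with respect to the tower below `α`. -/
def Pos (r : ι → ι → Prop) (α : ι) (v : ι → Set Blocks) (φ : ι → ∀ n, Finset (Fin n))
    (S : Set Blocks) : Prop :=
  ∀ F : Finset ι, (∀ β ∈ F, β < α) → ∀ m, ∃ n ≥ m, ∃ E : Fin n → Finset (Fin n), Good r φ F m E ∧
    ∀ g, (∀ k, g k ∈ E k) → ⟨n, g⟩ ∈ S ∧ ∀ β ∈ F, ⟨n, g⟩ ∈ v β

theorem Pos.mono {S S' : Set Blocks} (h : Pos r α v φ S) (hS : S ⊆ S') : Pos r α v φ S' := by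
  intro F hF m
  obtain ⟨n, hn, E, hE, hE'⟩ := h F hF m
  exact ⟨n, hn, E, hE, fun g hg => ⟨hS (hE' g hg).1, (hE' g hg).2⟩⟩

theorem pos_univ {t : ι → Task ι} (h : ∀ β < α, StageOK r (t β) β v φ) : Pos r α v φ univ := by
  intro F hF m
  rcases F.eq_empty_or_nonempty with rfl | hne
  · refine ⟨m, le_rfl, fun _ => Finset.univ, ⟨fun k => ⟨k, Finset.mem_univ k⟩, by simp, ?_⟩, by simp⟩
    exact fun T _ _ => ⟨Finset.univ, by simp, by simp⟩
  · have hγ := h _ (hF _ (F.max'_mem hne))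
    have h1 : ∀ᶠ n in atTop, ∀ β ∈ F, ∀ g, ⟨n, g⟩ ∈ v (F.max' hne) → ⟨n, g⟩ ∈ v β := by
      rw [Filter.eventually_all_finset]
      intro β hβ
      rcases (F.le_max' β hβ).lt_or_eq with hlt | heq
      · exact hγ.tower β hlt
      · rw [← heq]; exact Eventually.of_forall fun _ _ h => h
    obtain ⟨n, ⟨g, hg⟩, hn1, hn2, hnm⟩ := (hγ.frequently.and_eventually
      (h1.and ((hγ.good F (fun β hβ => F.le_max' β hβ) m).and (eventually_ge_atTop m)))).exists
    obtain ⟨E, hE, hE'⟩ := hn2 g hg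
    exact ⟨n, hnm, E, hE, fun g' hg' => ⟨mem_univ _, fun β hβ => hn1 β hβ g' (hE' g' hg')⟩⟩

/-- If both parts failed, a sufficiently good box for the union of the two failing requirements
could be homogenized for `a`, and the homogeneous box would meet one of them. -/
theorem Pos.inter_or_diff (htrans : ∀ a b c, r a b → r b c → r a c) (hrefl : ∀ a, r a a)
    {S : Set Blocks} (h : Pos r α v φ S) (a : Set Blocks) :
    Pos r α v φ (S ∩ a) ∨ Pos r α v φ (S \ a) := by
  classical
  by_contra! hcon
  obtain ⟨h1, h2⟩ := hcon
  simp only [Pos, not_forall] at h1 h2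
  obtain ⟨F₁, hF₁, m₁, h1⟩ := h1
  obtain ⟨F₂, hF₂, m₂, h2⟩ := h2
  obtain ⟨M, hM⟩ := exists_good_partition r φ (F₁ ∪ F₂) (max m₁ m₂)
  obtain ⟨n, hn, E, hE, hE'⟩ := h (F₁ ∪ F₂) (fun β hβ => (Finset.mem_union.1 hβ).elim (hF₁ β) (hF₂ β))
    (max M (max m₁ m₂))
  obtain ⟨E₁, hE₁, hgood, hor⟩ := hM E (hE.anti htrans hrefl (Finset.Subset.refl _) (le_max_left _ _))
    {g | ⟨n, g⟩ ∈ a}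
  have hmem := fun g (hg : ∀ k, g k ∈ E₁ k) => hE' g fun k => hE₁ k (hg k)
  rcases hor with hor | hor
  · exact h1 ⟨n, (le_max_left _ _).trans ((le_max_right _ _).trans hn), E₁,
      hgood.anti htrans hrefl Finset.subset_union_left (le_max_left _ _),
      fun g hg => ⟨⟨(hmem g hg).1, hor g hg⟩,
        fun β hβ => (hmem g hg).2 β (Finset.mem_union_left _ hβ)⟩⟩
  · exact h2 ⟨n, (le_max_right _ _).trans ((le_max_right _ _).trans hn), E₁,
      hgood.anti htrans hrefl Finset.subset_union_right (le_max_right _ _),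
      fun g hg => ⟨⟨(hmem g hg).1, hor g hg⟩,
        fun β hβ => (hmem g hg).2 β (Finset.mem_union_right _ hβ)⟩⟩

/-- A decreasing sequence of positive sets that decides `a`. -/
theorem exists_pos_seq (htrans : ∀ a b c, r a b → r b c → r a c) (hrefl : ∀ a, r a a)
    (h : Pos r α v φ univ) (a : ℕ → Set Blocks) :
    ∃ S : ℕ → Set Blocks, Antitone S ∧ (∀ i, Pos r α v φ (S i)) ∧
      ((∃ i, ∀ j, S j = (a i)ᶜ) ∨ ∀ i, S i ⊆ a i) := by
  -- If no complement is positive, intersecting with any `a i` preserves positivity, so the finite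
  -- intersections serve.
  by_cases hc : ∃ i, Pos r α v φ (a i)ᶜ
  · obtain ⟨i, hi⟩ := hc
    exact ⟨fun _ => (a i)ᶜ, fun _ _ _ => le_rfl, fun _ => hi, Or.inl ⟨i, fun _ => rfl⟩⟩
  · have hstep : ∀ {S} i, Pos r α v φ S → Pos r α v φ (S ∩ a i) := fun {S} i hS =>
      (hS.inter_or_diff htrans hrefl (a i)).resolve_right fun hd =>
        hc ⟨i, hd.mono fun p hp => hp.2⟩
    refine ⟨fun i => {p | ∀ j ≤ i, p ∈ a j}, fun i i' hi p hp j hj => hp j (hj.trans hi),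
      fun i => ?_, Or.inr fun i p hp => hp i le_rfl⟩
    induction i with
    | zero => exact (hstep 0 h).mono fun p hp j hj => by rw [Nat.le_zero.1 hj]; exact hp.2
    | succ i ih =>
      refine (hstep (i + 1) ih).mono fun p hp j hj => ?_
      rcases Nat.le_succ_iff.1 hj with hj | rfl
      · exact hp.1 j hj
      · exact hp.2

/-- A block number, a box in this block, and a set of labels. -/
abbrev Piece : Type := Σ n : ℕ, (Fin n → Finset (Fin n)) × Finset (Fin n)

/-- The pieces that satisfy the requirement `(i, F)`. -/
def goodPieces (r : ι → ι → Prop) (α : ι) (v : ι → Set Blocks) (φ : ι → ∀ n, Finset (Fin n))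
    (S : ℕ → Set Blocks) (i : ℕ) (F : Finset ι) : Set Piece :=
  {z | i < z.1 ∧ Tame i z.2.1 ∧
    (∀ g, (∀ k, g k ∈ z.2.1 k) → ⟨z.1, g⟩ ∈ S i ∧ ∀ β ∈ F, ⟨z.1, g⟩ ∈ v β) ∧
    ∀ φ' : ι → ∀ n, Finset (Fin n), (∀ β < α, φ' β = φ β) → φ' α z.1 = z.2.2 →
      Good r φ' (insert α F) i z.2.1}

theorem goodPieces_anti (htrans : ∀ a b c, r a b → r b c → r a c) (hrefl : ∀ a, r a a)
    {S : ℕ → Set Blocks} (hS : Antitone S) {i i' : ℕ} (hi : i ≤ i') {F F' : Finset ι} (hF : F ⊆ F') :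
    goodPieces r α v φ S i' F' ⊆ goodPieces r α v φ S i F := by
  rintro z ⟨h1, h2, h3, h4⟩
  exact ⟨hi.trans_lt h1, h2.anti hi,
    fun g hg => ⟨hS hi (h3 g hg).1, fun β hβ => (h3 g hg).2 β (hF hβ)⟩,
    fun φ' hφ hα => (h4 φ' hφ hα).anti htrans hrefl (Finset.insert_subset_insert _ hF) hi⟩

theorem goodPieces_nonempty (htrans : ∀ a b c, r a b → r b c → r a c)
    {S : ℕ → Set Blocks} (hpos : ∀ i, Pos r α v φ (S i)) (i : ℕ) {F : Finset ι}
    (hF : ∀ β ∈ F, β < α) : (goodPieces r α v φ S i F).Nonempty := by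
  -- Norm `2 * i` is needed because adding α halves it; `2 ^ F.card * (2 * i)` bounds the active
  -- labels, so `boxSize` of it gives tameness.
  obtain ⟨n, hn, E, hE, hE'⟩ := hpos i F hF (2 * i + 1 + boxSize (2 ^ F.card * (2 * i)) i)
  obtain ⟨A, E₁, hA, hE₁, hone, hbig, hgood⟩ := hE.exists_tame (m' := 2 * i) (by omega)
  obtain ⟨σ, hσ⟩ := (hgood E₁ (fun k => by
    by_cases hk : k ∈ A
    · exact Finset.card_pos.1 (by have := hbig k hk; omega)
    · exact Finset.card_pos.1 (by rw [hone k hk]; exact one_pos))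
    (fun k hk => by have := hbig k hk; omega)).exists_insert htrans
      (fun hα => (hF α hα).false)
  refine ⟨⟨n, E₁, σ⟩, by dsimp only; omega, ⟨A, hone, fun k hk => ?_⟩,
    fun g hg => hE' g fun k => hE₁ k (hg k), fun φ' hφ hα => hσ φ' (fun β hβ => hφ β (hF β hβ)) hα⟩
  exact (boxSize_mono hA le_rfl).trans (by have := hbig k hk; dsimp only; omega)

/-- Each term is chosen to meet the requirement indexed by the height of its predecessor, so that
later each box is large compared with all earlier blocks. -/
theorem exists_thin_seq {Q : Type*} (ht : Q → ℕ) (B : ℕ → Set Q)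
    {Z : Set Q} (hZ : Z.Infinite) (hB : ∀ i, (Z \ B i).Finite) :
    ∃ (z : ℕ → Q) (i : ℕ → ℕ), ∀ j, z j ∈ Z ∧ z j ∈ B (i j) ∧ i (j + 1) = ht (z j) := by
  have : ∀ i, ∃ z, z ∈ Z ∧ z ∈ B i := fun i => by
    obtain ⟨z, hz, hz'⟩ := (hZ.sdiff (hB i)).nonempty
    exact ⟨z, hz, by_contra fun h => hz' ⟨hz, h⟩⟩
  choose pick hpick using this
  let i : ℕ → ℕ := fun j => Nat.rec 0 (fun _ x => ht (pick x)) j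
  exact ⟨fun j => pick (i j), i, fun j => ⟨(hpick _).1, (hpick _).2, rfl⟩⟩

theorem exists_extension {T : ℕ → Type*} [∀ n, Nonempty (T n)] {n : ℕ → ℕ}
    (hn : Function.Injective n) (σ : ∀ j, T (n j)) : ∃ ψ : ∀ n, T n, ∀ j, ψ (n j) = σ j := by
  classical
  have : ∀ m, ∃ x : T m, ∀ j (h : n j = m), h ▸ σ j = x := fun m => by
    by_cases hm : ∃ j, n j = m
    · obtain ⟨j, rfl⟩ := hm
      refine ⟨σ j, fun j' h => ?_⟩
      obtain rfl := hn h
      rfl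
    · exact ⟨Classical.arbitrary _, fun j h => absurd ⟨j, h⟩ hm⟩
  choose ψ hψ using this
  exact ⟨ψ, fun j => (hψ _ j rfl).symm⟩

/-- There are fewer than continuum many requirements `(i, F)`, and finitely many of them follow from
a single one. Each is met in arbitrarily late blocks, so `exists_pseudoIntersection` applies. -/
theorem exists_infinite_pieces (hMA : MASigmaCentered) (hα : #(Iio α) < continuum)
    (htrans : ∀ a b c, r a b → r b c → r a c) (hrefl : ∀ a, r a a)
    {S : ℕ → Set Blocks} (hS : Antitone S) (hpos : ∀ i, Pos r α v φ (S i)) :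
    ∃ Z : Set Piece, Z.Infinite ∧ ∀ (i : ℕ) (F : Finset ι), (∀ β ∈ F, β < α) →
      (Z \ goodPieces r α v φ S i F).Finite := by
  classical
  let em : Finset (Iio α) → Finset ι := fun F => F.map (Function.Embedding.subtype _)
  have hem : ∀ F, ∀ β ∈ em F, β < α := fun F β hβ => by
    obtain ⟨γ, -, rfl⟩ := Finset.mem_map.1 hβ
    exact γ.2
  have hcard : #(ℕ × Finset (Iio α)) < continuum := by
    rw [mk_prod, lift_id, lift_id, mk_nat]
    refine mul_lt_of_lt aleph0_le_continuum aleph0_lt_continuum ?_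
    rcases finite_or_infinite (Iio α) with hfin | hinf
    · exact (lt_aleph0_of_finite _).trans aleph0_lt_continuum
    · rwa [mk_finset_of_infinite]
  obtain ⟨Z, hZ, hZ'⟩ := exists_pseudoIntersection hMA hcard
    (fun x : ℕ × Finset (Iio α) => goodPieces r α v φ S x.1 (em x.2)) (by
      intro s hfin
      obtain ⟨N, hN⟩ := (hfin.image Sigma.fst).bddAbove
      obtain ⟨z, hz⟩ := goodPieces_nonempty htrans hpos (max N (s.sup Prod.fst))
        (hem (s.biUnion Prod.snd))
      have hzN := hN ⟨z, fun x hx => goodPieces_anti htrans hrefl hS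
        ((Finset.le_sup (f := Prod.fst) hx).trans (le_max_right _ _))
        (Finset.map_subset_map.2 (Finset.subset_biUnion_of_mem Prod.snd hx)) hz, rfl⟩
      have := hz.1
      omega)
  refine ⟨Z, hZ, fun i F hF => ?_⟩
  have := hZ' (i, F.subtype (· < α))
  have hFe : em (F.subtype (· < α)) = F := by
    ext β
    refine ⟨fun h => ?_, fun hβ => Finset.mem_map.2 ⟨⟨β, hF β hβ⟩, Finset.mem_subtype.2 hβ, rfl⟩⟩
    obtain ⟨γ, hγ, rfl⟩ := Finset.mem_map.1 h
    exact Finset.mem_subtype.1 hγ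
  rwa [hFe] at this

/-- The new tower element is the union of the boxes of a thinned pseudo-intersection of pieces, each
shrunk to avoid the finitary map; the new label sets are read off from the same pieces. -/
theorem exists_stage (hMA : MASigmaCentered) (hα : #(Iio α) < continuum)
    (htrans : ∀ a b c, r a b → r b c → r a c) (hrefl : ∀ a, r a a) (t : ι → Task ι)
    (h : ∀ β < α, StageOK r (t β) β v φ) :
    ∃ w ψ, StageOK r (t α) α (Function.update v α w) (Function.update φ α ψ) := by
  classical
  obtain ⟨S, hS, hpos, hSa⟩ := exists_pos_seq htrans hrefl (pos_univ h) (t α).seq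
  obtain ⟨Z, hZ, hZgood⟩ := exists_infinite_pieces hMA hα htrans hrefl hS hpos
  let F₀ : Finset ι := ({(t α).lo, (t α).hi} : Finset ι).filter (· < α)
  have hF₀ : ∀ β ∈ F₀, β < α := fun β hβ => (Finset.mem_filter.1 hβ).2
  -- Norm 2 over `F₀` makes every box nontrivial at some label separating `hi` from `lo`.
  obtain ⟨z, i, hz⟩ := exists_thin_seq Sigma.fst (fun i => goodPieces r α v φ S i ∅)
    (Z := Z ∩ goodPieces r α v φ S 2 F₀)
    (by rw [← sdiff_sdiff_right_self]; exact hZ.sdiff (hZgood 2 F₀ hF₀))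
    (fun i => (hZgood i ∅ (by simp)).subset fun x hx => ⟨hx.1.1, hx.2⟩)
  have hi : StrictMono i := strictMono_nat_of_lt_succ fun j => by
    rw [(hz j).2.2]; exact (hz j).2.1.1
  have hn : StrictMono fun j => (z j).1 := fun j j' hj => by
    have := hi (Nat.succ_lt_succ hj)
    simpa only [Nat.succ_eq_add_one, (hz _).2.2] using this
  have hni : ∀ {j j'}, (z j').1 < (z j).1 → (z j').1 ≤ i j := fun {j j'} hlt => by
    rw [← (hz j').2.2]
    exact hi.monotone (hn.lt_iff_lt.1 hlt)
  have hev : ∀ (k : ℕ) (F : Finset ι), (∀ β ∈ F, β < α) →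
      ∀ᶠ j in atTop, z j ∈ goodPieces r α v φ S k F := fun k F hF => by
    have hinj : Function.Injective z := fun a b hab => hn.injective (congrArg Sigma.fst hab)
    rw [← Nat.cofinite_eq_atTop, eventually_cofinite]
    exact ((hZgood k F hF).preimage hinj.injOn).subset fun j hj => ⟨(hz j).1.1, hj⟩
  obtain ⟨ψ, hψ⟩ := exists_extension (T := fun n => Finset (Fin n)) hn.injective fun j => (z j).2.2
  set φ' := Function.update φ α ψ with hφ'
  have hφlt : ∀ β < α, φ' β = φ β := fun β hβ => Function.update_of_ne hβ.ne _ _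
  have hφα : ∀ j, φ' α (z j).1 = (z j).2.2 := fun j => by rw [hφ', Function.update_self, hψ]
  have hshrink : ∀ j, ∃ E' : Fin (z j).1 → Finset (Fin (z j).1), (∀ k, E' k ⊆ (z j).2.1 k) ∧
      (∀ k, (E' k).Nonempty) ∧ (∀ k, 2 ≤ ((z j).2.1 k).card → i j ≤ (E' k).card ∨
        E' k = (z j).2.1 k) ∧
      ((t α).lo ≤ α → (t α).hi ≤ α → ¬ r (t α).hi (t α).lo → ∀ s : Finset Blocks,
        (∀ p ∈ s, p.1 ≤ i j ∨ ∃ g, (∀ k, g k ∈ E' k) ∧ p = ⟨(z j).1, proj (φ' (t α).lo (z j).1) g⟩) →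
        ∀ g, (∀ k, g k ∈ E' k) → (t α).code s (z j).1 ≠ proj (φ' (t α).hi (z j).1) g) := by
    intro j
    have hgood := (hz j).1.2.2.2.2 φ' hφlt (hφα j)
    by_cases hc : (t α).lo ≤ α ∧ (t α).hi ≤ α ∧ ¬ r (t α).hi (t α).lo
    · obtain ⟨hlo, hhi, hr⟩ := hc
      have hmem : ∀ β ≤ α, β = (t α).lo ∨ β = (t α).hi → β ∈ insert α F₀ := fun β hβ hor => by
        rcases hβ.lt_or_eq with hlt | rfl
        · exact Finset.mem_insert_of_mem (Finset.mem_filter.2 ⟨by simpa using hor, hlt⟩)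
        · exact Finset.mem_insert_self _ _
      -- The type generated by `hi` omits `lo`, so a label `k₀` realizing it is seen by the
      -- `hi`-projection only.
      obtain ⟨A, hA, hA'⟩ := hgood.types ((insert α F₀).filter (r (t α).hi ·))
        (Finset.filter_subset _ _) (fun β hβ γ hγ hβγ => Finset.mem_filter.2
          ⟨hγ, htrans _ _ _ (Finset.mem_filter.1 hβ).2 hβγ⟩)
      obtain ⟨k₀, hk₀⟩ := Finset.card_pos.1 (show 0 < A.card by omega)
      obtain ⟨hcard, htype⟩ := hA' k₀ hk₀
      obtain ⟨E', h1, h2, h3, h4⟩ := exists_avoiding_box (hz j).2.1.2.1 hcard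
        (b := φ' (t α).hi (z j).1) (a := φ' (t α).lo (z j).1)
        ((htype _ (hmem _ hhi (Or.inr rfl))).2
          (Finset.mem_filter.2 ⟨hmem _ hhi (Or.inr rfl), hrefl _⟩))
        (fun hk => hr (Finset.mem_filter.1 ((htype _ (hmem _ hlo (Or.inl rfl))).1 hk)).2)
        (fun s => (t α).code s (z j).1)
      exact ⟨E', h1, h2, fun k hk => Or.inl (h3 k hk), fun _ _ _ => h4⟩
    · exact ⟨(z j).2.1, fun k => Finset.Subset.refl _, hgood.nonempty, fun k _ => Or.inr rfl,
        fun h1 h2 h3 => absurd ⟨h1, h2, h3⟩ hc⟩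
  choose E hEsub hEne hEbig hEcode using hshrink
  let w : Set Blocks := {p | ∃ j, ∃ g, (∀ k, g k ∈ E j k) ∧ p = ⟨(z j).1, g⟩}
  have hw : ∀ j g, (⟨(z j).1, g⟩ : Blocks) ∈ w ↔ ∀ k, g k ∈ E j k := fun j g => by
    refine ⟨?_, fun hg => ⟨j, g, hg, rfl⟩⟩
    rintro ⟨j', g', hg', heq⟩
    obtain rfl : j = j' := hn.injective (Sigma.mk.inj_iff.1 heq).1
    cases heq
    exact hg'
  have hwS : ∀ j g, (⟨(z j).1, g⟩ : Blocks) ∈ w → (⟨(z j).1, g⟩ : Blocks) ∈ S (i j) :=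
    fun j g hg => ((hz j).2.1.2.2.1 g fun k => hEsub j k ((hw j g).1 hg k)).1
  have hlift : ∀ {P : ∀ n, (Fin n → Fin n) → Prop},
      (∀ᶠ j in atTop, ∀ g, (∀ k, g k ∈ E j k) → P (z j).1 g) →
      ∀ᶠ n in atTop, ∀ g, (⟨n, g⟩ : Blocks) ∈ w → P n g := fun {P} hP => by
    obtain ⟨J, hJ⟩ := eventually_atTop.1 hP
    filter_upwards [eventually_ge_atTop (z J).1] with n hnJ g hg
    obtain ⟨j, g', hg', heq⟩ := hg
    obtain rfl : n = (z j).1 := congrArg Sigma.fst heq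
    cases heq
    exact hJ j (hn.le_iff_le.1 hnJ) _ hg'
  refine ⟨w, ψ, ?_, ?_, ?_, ?_, ?_⟩
  · rw [Function.update_self]
    refine frequently_atTop.2 fun N => ⟨(z N).1, hn.le_apply, ?_⟩
    choose g hg using hEne N
    exact ⟨g, (hw N g).2 hg⟩
  · intro β hβ
    rw [Function.update_self, Function.update_of_ne hβ.ne]
    refine hlift ?_
    filter_upwards [hev 0 {β} (by simpa using hβ)] with j hj g hg
    exact (hj.2.2.1 g fun k => hEsub j k (hg k)).2 β (Finset.mem_singleton_self β)
  · intro F hF m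
    rw [Function.update_self]
    refine hlift (P := fun n _ => ∃ E : Fin n → Finset (Fin n), Good r φ' F m E ∧
      ∀ g', (∀ k, g' k ∈ E k) → (⟨n, g'⟩ : Blocks) ∈ w) ?_
    -- With `m + 2`, the labels that matter carry at least two values, hence keep at least `i j`
    -- values, or all of them, after shrinking.
    filter_upwards [hev (m + 2) (F.filter (· < α)) (fun β hβ => (Finset.mem_filter.1 hβ).2),
      eventually_ge_atTop m] with j hj hjm g hg
    refine ⟨E j, ?_, fun g' hg' => (hw j g').2 hg'⟩
    refine ((hj.2.2.2 φ' hφlt (hφα j)).anti htrans hrefl (F' := F) (m' := m + 2) (fun β hβ => ?_)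
      le_rfl).shrink (Nat.le_add_right _ _) (hEne j) fun k hk => ?_
    · rcases (hF β hβ).lt_or_eq with hlt | rfl
      · exact Finset.mem_insert_of_mem (Finset.mem_filter.2 ⟨hβ, hlt⟩)
      · exact Finset.mem_insert_self _ _
    · rcases hEbig j k (by omega) with h1 | h1
      · exact (hjm.trans hi.le_apply).trans h1
      · rw [h1]; omega
  · rw [Function.update_self]
    rcases hSa with ⟨i₀, hi₀⟩ | hsub
    · left
      refine ⟨i₀, ?_⟩
      rintro p hp
      obtain ⟨j, g, hg, rfl⟩ := id hp
      have := hwS j g hp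
      rwa [hi₀] at this
    · right
      intro p hp q hq hpq i₁ hi₁
      obtain ⟨j, g, hg, rfl⟩ := id hp
      obtain ⟨j', g', hg', rfl⟩ := id hq
      exact hsub i₁ (hS (hi₁.trans (hni hpq)) (hwS j' g' hq))
  · intro hlo hhi hr s n hs g hg
    rw [Function.update_self] at hs hg
    obtain ⟨j, g', hg', heq⟩ := id hg
    obtain rfl : n = (z j).1 := congrArg Sigma.fst heq
    refine hEcode j hlo hhi hr s (fun p hp => ?_) g ((hw j g).1 hg)
    obtain ⟨hpn, q, hq, rfl⟩ := hs p hp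
    obtain ⟨j', g'', hg'', rfl⟩ := hq
    rcases hpn.lt_or_eq with hlt | heq'
    · exact Or.inl (hni hlt)
    · obtain rfl := hn.injective heq'
      exact Or.inr ⟨g'', hg'', rfl⟩

theorem exists_tower [WellFoundedLT ι] (hMA : MASigmaCentered) (hι : ∀ α : ι, #(Iio α) < continuum)
    (htrans : ∀ a b c, r a b → r b c → r a c) (hrefl : ∀ a, r a a) (t : ι → Task ι) :
    ∃ v φ, ∀ α, StageOK r (t α) α v φ := by
  obtain ⟨H, hH⟩ := exists_forall_of_step (D := Set Blocks × ∀ n, Finset (Fin n))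
    (fun α H => StageOK r (t α) α (fun β => (H β).1) fun β => (H β).2)
    (fun α H H' hHH' h => h.congr (fun β hβ => by rw [hHH' β hβ]) fun β hβ => by rw [hHH' β hβ])
    (fun α H h => by
      obtain ⟨w, ψ, hw⟩ := exists_stage hMA (hι α) htrans hrefl t h
      refine ⟨(w, ψ), hw.congr (fun β hβ => ?_) fun β hβ => ?_⟩ <;>
      · by_cases hβα : β = α
        · subst hβα; simp
        · simp [Function.update_of_ne hβα])
  exact ⟨_, _, hH⟩

end Stage

/-! ### The generic ultrafilter -/

theorem mk_task_le {ι : Type} (hι : #ι = continuum) : #(Task ι) ≤ continuum := by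
  have hinj : Function.Injective (fun t : Task ι =>
      ((t.seq, fun x : Finset Blocks × ℕ => (⟨x.2, t.code x.1 x.2⟩ : Blocks)), (t.lo, t.hi))) := by
    rintro ⟨a, c, x, y⟩ ⟨a', c', x', y'⟩ h
    simp only [Prod.mk.injEq] at h
    obtain ⟨⟨rfl, hc⟩, rfl, rfl⟩ := h
    obtain rfl : c = c' := by
      funext s n
      have := congrFun hc (s, n)
      simpa using this
    rfl
  refine (mk_le_of_injective hinj).trans ?_
  have h1 : #(ℕ → Set Blocks) ≤ continuum := by
    rw [← power_def, mk_set, mk_nat]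
    calc ((2 : Cardinal) ^ #Blocks) ^ ℵ₀ ≤ continuum ^ ℵ₀ := by
          refine power_le_power_right ?_
          rw [← two_power_aleph0]
          exact power_le_power_left two_ne_zero mk_le_aleph0
      _ = continuum := continuum_power_aleph0
  have h2 : #(Finset Blocks × ℕ → Blocks) ≤ continuum := by
    rw [← power_def]
    calc #Blocks ^ #(Finset Blocks × ℕ) ≤ ℵ₀ ^ #(Finset Blocks × ℕ) :=
          power_le_power_right mk_le_aleph0
      _ ≤ ℵ₀ ^ ℵ₀ := power_le_power_left aleph0_ne_zero mk_le_aleph0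
      _ = continuum := aleph0_power_aleph0
  simp only [mk_prod, lift_id, hι, continuum_mul_self]
  calc _ ≤ continuum * continuum * continuum := by gcongr
    _ = continuum := by rw [continuum_mul_self, continuum_mul_self]

/-- The filter generated by the tower `v` and the cofinite sets. -/
def towerFilter {ι : Type*} [LinearOrder ι] [Nonempty ι] (v : ι → Set Blocks)
    (hv : ∀ α, ∀ β < α, ∀ᶠ n in atTop, ∀ g, ⟨n, g⟩ ∈ v α → ⟨n, g⟩ ∈ v β) : Filter Blocks where
  sets := {S | ∃ α, ∀ᶠ n in atTop, ∀ g, ⟨n, g⟩ ∈ v α → ⟨n, g⟩ ∈ S}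
  univ_sets := ⟨Classical.arbitrary ι, Eventually.of_forall fun _ _ _ => mem_univ _⟩
  sets_of_superset := fun ⟨α, hα⟩ hST => ⟨α, hα.mono fun n hn g hg => hST (hn g hg)⟩
  inter_sets := by
    rintro S T ⟨α, hα⟩ ⟨β, hβ⟩
    rcases lt_trichotomy α β with h | rfl | h
    · refine ⟨β, ?_⟩
      filter_upwards [hα, hβ, hv β α h] with n h1 h2 h3 g hg
      exact ⟨h1 g (h3 g hg), h2 g hg⟩
    · refine ⟨α, ?_⟩
      filter_upwards [hα, hβ] with n h1 h2 g hg
      exact ⟨h1 g hg, h2 g hg⟩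
    · refine ⟨α, ?_⟩
      filter_upwards [hα, hβ, hv α β h] with n h1 h2 h3 g hg
      exact ⟨h1 g hg, h2 g (h3 g hg)⟩

/-- The properties of the ultrafilter `𝒰` and the sets of labels `φ` that the embedding is read off
from. -/
structure IsGeneric {ι : Type*} (r : ι → ι → Prop) (𝒰 : Ultrafilter Blocks)
    (φ : ι → ∀ n, Finset (Fin n)) : Prop where
  fst_lt : ∀ i, {p : Blocks | i < p.1} ∈ 𝒰
  diag : ∀ a : ℕ → Set Blocks, (∀ i, a i ∈ 𝒰) →
    ∃ v ∈ 𝒰, ∀ p ∈ v, ∀ q ∈ v, p.1 < q.1 → ∀ i ≤ p.1, q ∈ a i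
  mono : ∀ x y, r x y → {p : Blocks | φ x p.1 ⊆ φ y p.1} ∈ 𝒰
  avoid : ∀ x y, ¬ r y x → ∀ f : Finset Blocks → ∀ n, Fin n → Fin n, ∃ v ∈ 𝒰,
    ∀ (s : Finset Blocks) (n : ℕ), (∀ p ∈ s, p.1 ≤ n ∧ p ∈ projBlocks (φ x) '' v) →
      ∀ g, ⟨n, g⟩ ∈ v → f s n ≠ proj (φ y n) g

theorem exists_generic (hMA : MASigmaCentered) {ι : Type} [LinearOrder ι] [WellFoundedLT ι]
    (hι : #ι = continuum) (hlt : ∀ α : ι, #(Iio α) < continuum) {r : ι → ι → Prop}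
    (htrans : ∀ a b c, r a b → r b c → r a c) (hrefl : ∀ a, r a a) :
    ∃ 𝒰 φ, IsGeneric r 𝒰 φ := by
  classical
  have : Nonempty ι := by
    rw [← mk_ne_zero_iff, hι]; exact continuum_ne_zero
  have x₀ : ι := Classical.arbitrary ι
  have f₀ : Finset Blocks → ∀ n, Fin n → Fin n := fun _ _ => id
  have : Nonempty (Task ι) := ⟨⟨fun _ => ∅, f₀, x₀, x₀⟩⟩
  obtain ⟨t, ht⟩ := exists_bookkeeping hι hlt (mk_task_le hι)
  obtain ⟨v, φ, hOK⟩ := exists_tower hMA hlt htrans hrefl t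
  let 𝒱 := towerFilter v fun α => (hOK α).tower
  have hmem : ∀ α, v α ∈ 𝒱 := fun α => ⟨α, Eventually.of_forall fun _ _ h => h⟩
  have hlarge : ∀ i, {p : Blocks | i < p.1} ∈ 𝒱 := fun i =>
    ⟨x₀, (eventually_gt_atTop i).mono fun n hn _ _ => hn⟩
  have hne : ∀ S ∈ 𝒱, S.Nonempty := by
    rintro S ⟨α, hα⟩
    obtain ⟨n, ⟨g, hg⟩, hn⟩ := ((hOK α).frequently.and_eventually hα).exists
    exact ⟨_, hn g hg⟩
  have hseq : ∀ a : ℕ → Set Blocks, (∃ i, (a i)ᶜ ∈ 𝒱) ∨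
      ∃ w ∈ 𝒱, ∀ p ∈ w, ∀ q ∈ w, p.1 < q.1 → ∀ i ≤ p.1, q ∈ a i := fun a => by
    obtain ⟨α, -, hα⟩ := ht ⟨a, f₀, x₀, x₀⟩ x₀
    have := (hOK α).seq
    rw [hα] at this
    rcases this with ⟨i, hi⟩ | h
    · exact Or.inl ⟨i, mem_of_superset (hmem α) hi⟩
    · exact Or.inr ⟨v α, hmem α, h⟩
  have hultra : ∀ S, Sᶜ ∉ 𝒱 ↔ S ∈ 𝒱 := by
    refine fun S => ⟨fun hS => ?_, fun hS hSc => ?_⟩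
    · rcases hseq fun _ => S with ⟨_, h⟩ | ⟨w, hw, h⟩
      · exact absurd h hS
      · obtain ⟨p, hp⟩ := hne w hw
        filter_upwards [hw, hlarge p.1] with q hq hpq
        exact h p hp q hq hpq 0 (Nat.zero_le _)
    · obtain ⟨p, hp⟩ := hne _ (inter_mem hS hSc)
      exact hp.2 hp.1
  refine ⟨Ultrafilter.ofComplNotMemIff 𝒱 hultra, φ, ⟨hlarge, fun a ha => ?_, fun x y hxy => ?_,
    fun x y hxy f => ?_⟩⟩
  · rcases hseq a with ⟨i, h⟩ | h
    · exact absurd h ((hultra _).2 (ha i))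
    · exact h
  · refine ⟨max x y, ?_⟩
    filter_upwards [(hOK (max x y)).good {x, y} (by simp) 0] with n hn g hg
    obtain ⟨E, hE, -⟩ := hn g hg
    exact hE.mono x (by simp) y (by simp) hxy
  · obtain ⟨α, hα, hαt⟩ := ht ⟨fun _ => ∅, f, x, y⟩ (max x y)
    have := (hOK α).code
    rw [hαt] at this
    exact ⟨v α, hmem α, this ((le_max_left _ _).trans hα) ((le_max_right _ _).trans hα) hxy⟩

/-! ### Reducibilities -/

theorem RKLE.tukeyLE {U V : Ultrafilter ℕ} (h : RKLE (U : Filter ℕ) (V : Filter ℕ)) :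
    TukeyLE U.RevIncl V.RevIncl := by
  obtain ⟨f, hf⟩ := h
  refine ⟨fun A => OrderDual.toDual ⟨f '' (OrderDual.ofDual A).1,
    (hf _).2 (mem_of_superset (OrderDual.ofDual A).2 (subset_preimage_image f _))⟩, fun S hS B => ?_⟩
  obtain ⟨A, hA, hBA⟩ := hS (OrderDual.toDual ⟨f ⁻¹' (OrderDual.ofDual B).1,
    (hf _).1 (OrderDual.ofDual B).2⟩)
  exact ⟨_, mem_image_of_mem _ hA, image_subset_iff.2 hBA⟩

/-- Take for `H a` the union of the values of the Tukey map at members of `U` inside a. If no `H a`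
were contained in b, the members whose value is not contained in b would be cofinal, while their
values never go below b. -/
theorem exists_monotone_of_tukeyLE {U V : Ultrafilter ℕ} (h : TukeyLE V.RevIncl U.RevIncl) :
    ∃ H : Set ℕ → Set ℕ, Monotone H ∧ (∀ a ∈ U, H a ∈ V) ∧ ∀ b ∈ V, ∃ a ∈ U, H a ⊆ b := by
  obtain ⟨g, hg⟩ := h
  let G : ∀ a, a ∈ U → Set ℕ := fun a ha => (OrderDual.ofDual (g (OrderDual.toDual ⟨a, ha⟩))).1
  refine ⟨fun a => {k | ∃ a', ∃ ha' : a' ∈ U, a' ⊆ a ∧ k ∈ G a' ha'}, ?_, fun a ha => ?_,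
    fun b hb => ?_⟩
  · rintro a a' haa' k ⟨c, hc, hca, hk⟩
    exact ⟨c, hc, hca.trans haa', hk⟩
  · exact mem_of_superset (OrderDual.ofDual (g (OrderDual.toDual ⟨a, ha⟩))).2
      fun k hk => ⟨a, ha, Subset.rfl, hk⟩
  · by_contra! hcon
    obtain ⟨_, ⟨A, hA, rfl⟩, hle⟩ := hg {A | ¬ (OrderDual.ofDual (g A)).1 ⊆ b} (fun A => by
      obtain ⟨k, ⟨a', ha', hsub, hk⟩, hkb⟩ := not_subset.1 (hcon _ (OrderDual.ofDual A).2)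
      exact ⟨OrderDual.toDual ⟨a', ha'⟩, fun hs => hkb (hs hk), hsub⟩)
      (OrderDual.toDual ⟨b, hb⟩)
    exact hA hle

section Generic

variable {ι : Type*} {r : ι → ι → Prop} {𝒰 : Ultrafilter Blocks} {φ : ι → ∀ n, Finset (Fin n)}

/-- There is no monotone map with cofinal range between the projections of a generic ultrafilter
along `x` and `y` unless `r y x`. -/
theorem IsGeneric.not_exists_monotone (h : IsGeneric r 𝒰 φ) {x y : ι} (hxy : ¬ r y x)
    {H : Set Blocks → Set Blocks} (hmono : Monotone H)
    (hH : ∀ a ∈ 𝒰.map (projBlocks (φ x)), H a ∈ 𝒰.map (projBlocks (φ y)))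
    (hcof : ∀ b ∈ 𝒰.map (projBlocks (φ y)), ∃ a ∈ 𝒰.map (projBlocks (φ x)), H a ⊆ b) : False := by
  classical
  set X := 𝒰.map (projBlocks (φ x))
  set Y := 𝒰.map (projBlocks (φ y))
  have himage : ∀ z, ∀ w ∈ 𝒰, projBlocks (φ z) '' w ∈ 𝒰.map (projBlocks (φ z)) := fun z w hw =>
    Ultrafilter.mem_map.2 (mem_of_superset hw (subset_preimage_image _ _))
  let join : Finset Blocks → ℕ → Set Blocks → Set Blocks := fun s n a => ↑s ∪ {p ∈ a | n < p.1}
  -- `c s n k` is a tail that keeps `⟨n, k⟩` out of the value of `H` whenever some tail in `X` does.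
  -- For given n only finitely many of these tails matter, so they can be diagonalized.
  have hc : ∀ (s : Finset Blocks) (n : ℕ) (k : Fin n → Fin n), ∃ c ∈ X,
      (∃ a ∈ X, ⟨n, k⟩ ∉ H (join s n a)) → ⟨n, k⟩ ∉ H (join s n c) := by
    intro s n k
    by_cases hex : ∃ a ∈ X, ⟨n, k⟩ ∉ H (join s n a)
    · obtain ⟨a, ha, hk⟩ := hex
      exact ⟨a, ha, fun _ => hk⟩
    · exact ⟨univ, univ_mem, fun h => absurd h hex⟩
  choose c hcX hc using hc
  have hdX : ∀ n, {p | ∀ s ∈ (initialBlocks n).powerset, ∀ k, p ∈ c s n k} ∈ X := fun n => by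
    have : ∀ᶠ p in (X : Filter Blocks), ∀ s ∈ (initialBlocks n).powerset, ∀ k, p ∈ c s n k :=
      (eventually_all_finset _).2 fun s _ => eventually_all.2 fun k => hcX s n k
    exact this
  obtain ⟨v, hv, hvd⟩ := h.diag _ fun n => Ultrafilter.mem_map.1 (hdX n)
  -- The finitary map picks a point of block n that the finite part s alone forces into `H`; `id` is
  -- a dummy value.
  have hf : ∀ (s : Finset Blocks) (n : ℕ), ∃ k : Fin n → Fin n,
      (∃ k' : Fin n → Fin n, ∀ a ∈ X, ⟨n, k'⟩ ∈ H (join s n a)) →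
        ∀ a ∈ X, ⟨n, k⟩ ∈ H (join s n a) := by
    intro s n
    by_cases hex : ∃ k' : Fin n → Fin n, ∀ a ∈ X, ⟨n, k'⟩ ∈ H (join s n a)
    · obtain ⟨k, hk⟩ := hex
      exact ⟨k, fun _ => hk⟩
    · exact ⟨id, fun h => absurd h hex⟩
  choose f hf using hf
  obtain ⟨w, hw, hwf⟩ := h.avoid x y hxy f
  obtain ⟨a₁, ha₁, ha₁w⟩ := hcof _ (himage y w hw)
  set a := a₁ ∩ (projBlocks (φ x) '' v ∩ projBlocks (φ x) '' w)
  have haX : a ∈ X := inter_mem ha₁ (inter_mem (himage x v hv) (himage x w hw))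
  -- The diagonal property of `v` speaks only of blocks that `v` meets, so n must be one of them.
  have hK : {p : Blocks | ∃ q ∈ v, q.1 = p.1} ∈ Y :=
    Ultrafilter.mem_map.2 (mem_of_superset hv fun q hq => ⟨q, hq, rfl⟩)
  obtain ⟨⟨n, k⟩, hkH, q, hq, hqn⟩ := Ultrafilter.nonempty_of_mem (inter_mem (hH a haX) hK)
  let s : Finset Blocks := (initialBlocks n).filter (· ∈ a)
  have hs : ∀ p, p ∈ s ↔ p.1 ≤ n ∧ p ∈ a := fun p => by
    rw [Finset.mem_filter, mem_initialBlocks]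
  -- Otherwise `c s n k` excludes `⟨n, k⟩`; but beyond block n the set a lies inside it, so
  -- monotonicity contradicts `hkH`.
  have hdec : ∀ a' ∈ X, ⟨n, k⟩ ∈ H (join s n a') := by
    by_contra! hcon
    refine hc s n k hcon (hmono (fun p hp => ?_) hkH)
    rcases le_or_gt p.1 n with hpn | hpn
    · exact Or.inl ((hs p).2 ⟨hpn, hp⟩)
    · refine Or.inr ⟨?_, hpn⟩
      obtain ⟨p', hp', rfl⟩ := hp.2.1
      have hqp : q.1 < p'.1 := hqn ▸ hpn
      exact hvd q hq p' hp' hqp n hqn.ge s (Finset.mem_powerset.2 (Finset.filter_subset _ _)) k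
  have hfa := ha₁w (hmono (fun p hp => ?_) (hf s n ⟨k, hdec⟩ a haX) : _ ∈ H a₁)
  · obtain ⟨⟨n', g⟩, hp', heq⟩ := hfa
    obtain rfl : n' = n := congrArg Sigma.fst heq
    refine hwf s n' (fun p hp => ⟨((hs p).1 hp).1, ((hs p).1 hp).2.2.2⟩) g hp' ?_
    exact (eq_of_heq (Sigma.mk.inj_iff.1 heq).2).symm
  · rcases hp with hp | hp
    · exact ((hs p).1 hp).2.1
    · exact hp.1.1

/-- The ultrafilter on `ℕ` attached to `x`, for a numbering `e` of `Blocks`. -/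
noncomputable def projUltrafilter (𝒰 : Ultrafilter Blocks) (φ : ι → ∀ n, Finset (Fin n))
    (e : Blocks → ℕ) (x : ι) : Ultrafilter ℕ :=
  (𝒰.map (projBlocks (φ x))).map e

variable {e : Blocks → ℕ}

/-- If no fibre is in the ultrafilter, diagonalize the complements of the fibres: past a point of
block greater than m, the value m is no longer taken. -/
theorem IsGeneric.isPPoint (h : IsGeneric r 𝒰 φ) (he : Function.Injective e) (x : ι) :
    IsPPoint (projUltrafilter 𝒰 φ e x) := by
  have : Nonempty Blocks := ⟨⟨0, id⟩⟩
  have hmem : ∀ S : Set ℕ, S ∈ projUltrafilter 𝒰 φ e x ↔ {p | e (projBlocks (φ x) p) ∈ S} ∈ 𝒰 :=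
    fun S => Iff.rfl
  refine ⟨fun F hF => ?_, fun f => ?_⟩
  · obtain ⟨N, hN⟩ := (hF.image fun k => (Function.invFun e k).1).bddAbove
    rw [hmem]
    filter_upwards [h.fst_lt N] with p hp hpF
    have := hN ⟨_, hpF, rfl⟩
    simp only [Function.leftInverse_invFun he _] at this
    exact absurd hp (not_lt.2 this)
  · by_cases hex : ∃ m, {p | f (e (projBlocks (φ x) p)) = m} ∈ 𝒰
    · obtain ⟨m, hm⟩ := hex
      exact ⟨{k | f k = m}, hm, Or.inr ⟨m, fun n hn => hn⟩⟩
    · obtain ⟨v, hv, hvd⟩ := h.diag (fun m => {p | f (e (projBlocks (φ x) p)) ≠ m})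
        fun m => Ultrafilter.compl_mem_iff_notMem.2 fun hm => hex ⟨m, hm⟩
      refine ⟨(fun p => e (projBlocks (φ x) p)) '' v, (hmem _).2
        (mem_of_superset hv (subset_preimage_image _ _)), Or.inl fun m => ?_⟩
      obtain ⟨p, hp, hpm⟩ := Ultrafilter.nonempty_of_mem (inter_mem hv (h.fst_lt m))
      refine ((initialBlocks p.1).finite_toSet.image fun p => e (projBlocks (φ x) p)).subset ?_
      rintro _ ⟨⟨q, hq, rfl⟩, hqm⟩
      refine ⟨q, mem_initialBlocks.2 (not_lt.1 fun hlt => ?_), rfl⟩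
      exact hvd p hp q hq hlt m (le_of_lt hpm) hqm

theorem IsGeneric.rkLE (h : IsGeneric r 𝒰 φ) (he : Function.Injective e) {x y : ι} (hxy : r x y) :
    RKLE (projUltrafilter 𝒰 φ e x : Filter ℕ) (projUltrafilter 𝒰 φ e y : Filter ℕ) := by
  have : Nonempty Blocks := ⟨⟨0, id⟩⟩
  refine ⟨fun k => e (projBlocks (φ x) (Function.invFun e k)), fun S => ?_⟩
  have heq : ∀ p ∈ {p : Blocks | φ x p.1 ⊆ φ y p.1},
      e (projBlocks (φ x) (Function.invFun e (e (projBlocks (φ y) p)))) =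
        e (projBlocks (φ x) p) := fun p hp => by
    rw [Function.leftInverse_invFun he]
    congr 1
    simp only [projBlocks]
    rw [proj_proj hp]
  change {p | e (projBlocks (φ x) p) ∈ S} ∈ (𝒰 : Filter Blocks) ↔
    {p | e (projBlocks (φ x) (Function.invFun e (e (projBlocks (φ y) p)))) ∈ S} ∈
      (𝒰 : Filter Blocks)
  constructor <;> intro hS <;> filter_upwards [hS, h.mono x y hxy] with p hp hpm
  · rw [heq p hpm]; exact hp
  · rw [← heq p hpm]; exact hp

theorem IsGeneric.not_tukeyLE (h : IsGeneric r 𝒰 φ) (he : Function.Injective e) {x y : ι}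
    (hxy : ¬ r y x) :
    ¬ TukeyLE (projUltrafilter 𝒰 φ e y).RevIncl (projUltrafilter 𝒰 φ e x).RevIncl := by
  intro hT
  obtain ⟨H, hmono, hH, hcof⟩ := exists_monotone_of_tukeyLE hT
  have himage : ∀ z, ∀ a ∈ 𝒰.map (projBlocks (φ z)), e '' a ∈ projUltrafilter 𝒰 φ e z :=
    fun z a ha => Ultrafilter.mem_map.2 (mem_of_superset ha (subset_preimage_image _ _))
  refine h.not_exists_monotone hxy (H := fun a => e ⁻¹' H (e '' a))
    (fun a b hab => preimage_mono (hmono (image_mono hab)))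
    (fun a ha => Ultrafilter.mem_map.1 (hH _ (himage x a ha))) fun b hb => ?_
  obtain ⟨a, ha, hab⟩ := hcof _ (himage y b hb)
  refine ⟨e ⁻¹' a, Ultrafilter.mem_map.1 ha, ?_⟩
  rw [← preimage_image_eq b he]
  exact preimage_mono ((hmono (image_preimage_subset e a)).trans hab)

end Generic

/-- Under Martin's axiom for σ-centered posets, every preorder of size at most continuum embeds into
the P-points, with respect to both reducibilities. -/
theorem exists_embedding_of_preorder (hMA : MASigmaCentered) {X : Type} [Preorder X] [Nonempty X]
    (hX : #X ≤ continuum) : ∃ V : X → Ultrafilter ℕ, (∀ x, IsPPoint (V x)) ∧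
      (∀ x y, x ≤ y → RKLE (V x : Filter ℕ) (V y : Filter ℕ)) ∧
      ∀ x y, ¬ y ≤ x → ¬ TukeyLE (V y).RevIncl (V x).RevIncl := by
  let ι := (continuum.{0}).ord.ToType
  have hι : #ι = continuum := mk_ord_toType _
  obtain ⟨j⟩ := (le_def _ _).1 (hX.trans hι.ge)
  -- The well-order of `ι` only drives the recursion; the relation to be realized is the preorder of
  -- `X` pulled back along a left inverse of `j`.
  obtain ⟨𝒰, φ, h⟩ := exists_generic hMA hι (fun α => (mk_Iio_lt α (by rw [hι, Ordinal.type_toType])).trans_eq hι)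
    (r := fun α β => Function.invFun j α ≤ Function.invFun j β)
    (fun _ _ _ => le_trans) (fun _ => le_rfl)
  obtain ⟨e, he⟩ := Countable.exists_injective_nat Blocks
  have hj : ∀ x, Function.invFun j (j x) = x := Function.leftInverse_invFun j.injective
  refine ⟨fun x => projUltrafilter 𝒰 φ e (j x), fun x => h.isPPoint he _,
    fun x y hxy => h.rkLE he ?_, fun x y hxy => h.not_tukeyLE he ?_⟩
  · rwa [hj, hj]
  · rwa [hj, hj]

theorem mk_powModFin_le : #PowModFin ≤ continuum := by
  have : #PowModFin ≤ #(Set ℕ) := mk_quotient_le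
  rwa [mk_set, mk_nat, two_power_aleph0] at this

end PPointEmbedding

/-! ### The embedding of P(ω)/fin -/

open PPointEmbedding in
theorem theorem2 (hMA : MASigmaCentered) :
    ∃ (𝒳 : Set (Set ℕ)) (U : 𝒳 → Ultrafilter ℕ),
      ((∀ A ∈ 𝒳, ∀ B ∈ 𝒳, A ≠ B → ¬ AlmostEq A B) ∧ (∀ C : Set ℕ, ∃ A ∈ 𝒳, AlmostEq C A)) ∧
      (∀ A : 𝒳, IsPPoint (U A)) ∧
      (∀ A B : 𝒳, AlmostSubset A B → RKLE (U A : Filter ℕ) (U B : Filter ℕ)) ∧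
      (∀ A B : 𝒳, ¬ AlmostSubset B A → ¬ TukeyLE (U B).RevIncl (U A).RevIncl) ∧
      -- hence `P(ω)/fin` embeds into the P-points under both reducibilities
      (∃ V : PowModFin → Ultrafilter ℕ,
        (∀ A : 𝒳, V (PowModFin.mk A) = U A) ∧
        (∀ x, IsPPoint (V x)) ∧
        (∀ x y, x ≤ y ↔ RKLE (V x : Filter ℕ) (V y : Filter ℕ)) ∧
        (∀ x y, x ≤ y ↔ TukeyLE (V x).RevIncl (V y).RevIncl)) := by
  have : Nonempty PowModFin := ⟨PowModFin.mk ∅⟩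
  obtain ⟨V, hP, hRK, hT⟩ := exists_embedding_of_preorder hMA mk_powModFin_le
  have hout : ∀ x : PowModFin, PowModFin.mk (Quotient.out x) = x := fun x => Quotient.out_eq x
  refine ⟨Set.range (Quotient.out : PowModFin → Set ℕ), fun A => V (PowModFin.mk A), ⟨?_, ?_⟩,
    fun A => hP _, fun A B hAB => hRK _ _ hAB, fun A B hAB => hT _ _ hAB, V, fun _ => rfl, hP,
    fun x y => ⟨hRK x y, fun h => ?_⟩, fun x y => ⟨fun h => (hRK x y h).tukeyLE, fun h => ?_⟩⟩
  · rintro _ ⟨x, rfl⟩ _ ⟨y, rfl⟩ hne hxy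
    have : x = y := by
      rw [← hout x, ← hout y]
      exact Quotient.sound hxy
    exact hne (congrArg _ this)
  · intro C
    exact ⟨_, ⟨PowModFin.mk C, rfl⟩, Quotient.exact (hout (PowModFin.mk C)).symm⟩
  · by_contra hxy
    exact hT y x hxy h.tukeyLE
  · by_contra hxy
    exact hT y x hxy h
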